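/- **Setting.** Let $d\ge 1$, $n=2^d$. A tree circuit $C$ of depth $d$ is a full binary tree with $n$ leaves $x_1,\dots,x_n$ whose inner nodes carry gates in $\{\wedge,\vee,\neg\wedge,\neg\vee\}$ on $\{\pm1\}^2$ ($+1$ is true); $h_C:\{\pm1\}^n\to\{\pm1\}$ is the function it computes. Level $i$ has $2^i$ nodes, and the output gate is on level $0$. The generative distribution $\mathcal D_C$ on $\{\pm1\}^n\times\{\pm1\}$: draw the label $y$ uniformly from $\{\pm1\}$ and give the root the value $y$; then, level by level from the top, every gate independently draws, uniformly among the patterns in $\{\pm1\}^2$ on which it outputs its value, the values of its two children; the values of the leaves form $x$. **Algorithm 1 (layerwise gradient descent).** With $\sigma(t)=\max(t,0)$ and $\phi(t)=\max(\min(t,1),-1)$, a neural gate of width $k$ is $g_{w,v}(x)=\phi\big(\sum_{l=1}^k v_l\,\sigma(\langle w_l,x\rangle)\big)$, $x\in\mathbb R^2$. A block $B_{W,V}:\mathbb R^{2^{i+1}}\to\mathbb R^{2^i}$ applies $2^i$ neural gates to consecutive pairs of coordinates. $P$ is average pooling. On a sample $S$ of $m$ labelled examples, $L_S(f)=\frac1m\sum_{(x,y)\in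 S}\big(\max(1-yf(x),0)+\lambda|1-f(x)|\big)$. Start with $\mathcal N_d=\mathrm{id}$. For $i=d-1,\dots,0$, initialize $W,V$ for the block with $2^i$ gates, perform $T$ steps $W\leftarrow W-\eta\,\partial_W L_S\big(P\circ B_{W,V}\circ\mathcal N_{i+1}\big)$ with $V$ fixed (gradients by the chain rule, with derivative $0$ at the kinks of the scalar functions), and put $\mathcal N_i=B_{W,V}\circ\mathcal N_{i+1}$. Return $\mathcal N_0$. Initialization: the pairs $(w_l,v_l)$ of all neurons are independent, $v_l$ is uniform on $\{\pm1\}$ and independent of $w_l$, and $w_l$ has a law $\mu$ on $\mathbb R^2$ with $\|w\|_\infty\le\frac1{4\sqrt2k}$ almost surely and $\mu(\langle w,p\rangle>0)=\frac12$ for each $p\in\{\pm1\}^2$ (for example uniform on a square). **Statement.** Put $\Delta=(2/3)^d$ and $\epsilon=4^{-d}$, and for $\delta\in(0,\frac12)$ call $(k,m,T,\eta)$ *admissible* if $$k\ge\frac{\log(2nd/\delta)}{\log(4/3)},\quad 0<\eta\le\frac1{16\sqrt2\,k},\quad m>\frac{2^{11}}{\epsilon^2\Delta^2}\log\frac{8nd}{\delta},\quad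 T>\frac{6n}{\sqrt2\,\eta\,\epsilon\,\Delta}.$$ 1. For every $d\ge1$, every tree circuit $C$ of depth $d$ with gates in $\{\wedge,\vee,\neg\wedge,\neg\vee\}$ and every $\delta\in(0,\frac12)$: $y=h_C(x)$ for $\mathcal D_C$-almost every $(x,y)$; and for all admissible $(k,m,T,\eta)$ and every $\mu$ as above, with $\lambda=\mathbb E_{\mathcal D_C}[y]+\frac\Delta4$, Algorithm 1 run on $m$ i.i.d. examples from $\mathcal D_C$ (independent of the initialization) returns, with probability at least $1-\delta$, a network with $\mathcal N_0(x)=h_C(x)$ for all $x\in\{\pm1\}^n$. 2. The sample complexity and run-time are polynomial: there is a constant $A$ such that for every $d\ge1$ and $\delta\in(0,\frac12)$ there are admissible $(k,m,T,\eta)$ with $m\le A\,(n+\log\frac1\delta)^A$ for which every run of Algorithm 1, as a program on a unit-cost real random access machine, takes at most $A\,(n+\log\frac1\delta)^A$ steps. -/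

import Mathlib

open MeasureTheory

noncomputable section

namespace TreeLearn

/-! ## Tree-structured AND/OR circuits

The bits `±1` are encoded by `Bool`: `true` is `+1` (true) and `false` is `-1` (false). -/

/-- The real number `±1` encoded by a bit. -/
def sgn (b : Bool) : ℝ := if b then 1 else -1

/-- The gates `∧, ∨, ¬∧, ¬∨`. -/
inductive Gate where
  | and | or | nand | nor

/-- The Boolean function of two bits computed by a gate. -/
def Gate.eval : Gate → Bool → Bool → Bool
  | .and, a, b => a && b
  | .or, a, b => a || b
  | .nand, a, b => !(a && b)
  | .nor, a, b => !(a || b)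

/-- A full binary tree circuit of depth `d` with `2 ^ d` input bits: `C i j` is the gate at node `j`
of level `i` (the output gate is on level `0`). -/
def Circuit (d : ℕ) : Type := (i : Fin d) → Fin (2 ^ (i : ℕ)) → Gate

/-- The left child of node `j` of level `i`, among the nodes of level `i + 1`. -/
def left {i : ℕ} (j : Fin (2 ^ i)) : Fin (2 ^ (i + 1)) :=
  ⟨2 * j, by have := j.isLt; rw [pow_succ]; omega⟩

/-- The right child of node `j` of level `i`, among the nodes of level `i + 1`. -/
def right {i : ℕ} (j : Fin (2 ^ i)) : Fin (2 ^ (i + 1)) :=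
  ⟨2 * j + 1, by have := j.isLt; rw [pow_succ]; omega⟩

/-- The parent of node `t` of level `i + 1`. -/
def parent {i : ℕ} (t : Fin (2 ^ (i + 1))) : Fin (2 ^ i) :=
  ⟨(t : ℕ) / 2, by have h := t.isLt; have e := pow_succ 2 i; omega⟩

/-- The pair of inputs of node `j` of level `i`. -/
def pair {α : Type} {i : ℕ} (x : Fin (2 ^ (i + 1)) → α) (j : Fin (2 ^ i)) : α × α :=
  (x (left j), x (right j))

/-- The vector `[x'₁, x'₂, …]` obtained by writing pairs one after the other. -/
def flatten {α : Type} {i : ℕ} (x' : Fin (2 ^ i) → α × α) : Fin (2 ^ (i + 1)) → α :=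
  fun t => if (t : ℕ) % 2 = 0 then (x' (parent t)).1 else (x' (parent t)).2

/-- The map computed by the gates of level `i`. -/
def Circuit.layer {d : ℕ} (C : Circuit d) (i : Fin d) (x : Fin (2 ^ ((i : ℕ) + 1)) → Bool) :
    Fin (2 ^ (i : ℕ)) → Bool :=
  fun j => (C i j).eval (pair x j).1 (pair x j).2

/-- The output of the circuit when the values at the `2 ^ i` nodes of level `i` are given. -/
def Circuit.evalFrom {d : ℕ} (C : Circuit d) : (i : ℕ) → i ≤ d → (Fin (2 ^ i) → Bool) → Bool
  | 0, _, x => x 0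
  | i + 1, h, x => C.evalFrom i (Nat.le_of_succ_le h) (C.layer ⟨i, h⟩ x)

/-- The function `h_C : {±1}ⁿ → {±1}`, `n = 2 ^ d`, computed by the circuit. -/
def Circuit.eval {d : ℕ} (C : Circuit d) : (Fin (2 ^ d) → Bool) → Bool := C.evalFrom d le_rfl

/-! ## The top-down generative distribution -/

/-- The patterns on which the gate `g` outputs `b`. -/
def Gate.patterns (g : Gate) (b : Bool) : Finset (Bool × Bool) :=
  Finset.univ.filter fun p => g.eval p.1 p.2 = b

theorem Gate.patterns_nonempty (g : Gate) (b : Bool) : (g.patterns b).Nonempty := by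
  cases g <;> cases b <;> decide

/-- The joint law of independent random variables with laws `p j`. -/
def indep {ι α : Type} [Fintype ι] [DecidableEq ι] [Fintype α] [MeasurableSpace α]
    [MeasurableSingletonClass α] (p : ι → PMF α) : PMF (ι → α) :=
  (Measure.pi fun j => (p j).toMeasure).toPMF

/-- The distribution `D⁽ⁱ⁾` on `{±1}^(2^i) × {±1}`: the label is uniform and equal to the value at the
root; given `(z, y) ∼ D⁽ⁱ⁾`, each gate `j` of level `i` draws, independently of the others, a
uniform input pattern among those on which it outputs `z j`; the drawn patterns form `x`, and
`(x, y) ∼ D⁽ⁱ⁺¹⁾`. -/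
def Circuit.gen {d : ℕ} (C : Circuit d) : (i : ℕ) → i ≤ d → PMF ((Fin (2 ^ i) → Bool) × Bool)
  | 0, _ => (PMF.uniformOfFintype Bool).map fun y => (fun _ => y, y)
  | i + 1, h => (C.gen i (Nat.le_of_succ_le h)).bind fun zy =>
      (indep fun j : Fin (2 ^ i) =>
        PMF.uniformOfFinset ((C ⟨i, h⟩ j).patterns (zy.1 j))
          ((C ⟨i, h⟩ j).patterns_nonempty (zy.1 j))).map
        fun x' => (flatten x', zy.2)

/-- The generative distribution `D = D⁽ᵈ⁾` on labelled examples. -/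
def Circuit.dist {d : ℕ} (C : Circuit d) : PMF ((Fin (2 ^ d) → Bool) × Bool) := C.gen d le_rfl

/-- The mean label `𝔼_D[y]`. -/
def Circuit.meanLabel {d : ℕ} (C : Circuit d) : ℝ := ∫ s, sgn s.2 ∂C.dist.toMeasure

/-! ## The network -/

def relu (z : ℝ) : ℝ := max z 0

def hardTanh (z : ℝ) : ℝ := max (min z 1) (-1)

/-- Inner product on `ℝ²`. -/
def dot (w x : ℝ × ℝ) : ℝ := w.1 * x.1 + w.2 * x.2

/-- The input of the output node of a neural gate with `k` hidden neurons. -/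
def preact {k : ℕ} (w : Fin k → ℝ × ℝ) (v : Fin k → ℝ) (x : ℝ × ℝ) : ℝ :=
  ∑ l, v l * relu (dot (w l) x)

/-- The neural gate `g_{w,v} : ℝ² → ℝ`. -/
def neuralGate {k : ℕ} (w : Fin k → ℝ × ℝ) (v : Fin k → ℝ) (x : ℝ × ℝ) : ℝ :=
  hardTanh (preact w v x)

/-- The block `B_{W,V} : ℝ^(2^(i+1)) → ℝ^(2^i)`. -/
def block {k i : ℕ} (W : Fin (2 ^ i) → Fin k → ℝ × ℝ) (V : Fin (2 ^ i) → Fin k → ℝ)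
    (x : Fin (2 ^ (i + 1)) → ℝ) : Fin (2 ^ i) → ℝ :=
  fun j => neuralGate (W j) (V j) (pair x j)

/-- Average pooling. -/
def avgPool {n : ℕ} (x : Fin n → ℝ) : ℝ := (∑ j, x j) / n

/-- The hinge loss, as a function of the prediction `p` for a fixed label `y`. -/
def hinge (y p : ℝ) : ℝ := max (1 - y * p) 0

/-- The regularization term. -/
def reg (lam p : ℝ) : ℝ := lam * |1 - p|

/-- The loss on a sample, with inputs `z s` and labels `y s`, of the predictor `f`. -/
def sampleLoss {m : ℕ} {X : Type} (lam : ℝ) (z : Fin m → X) (y : Fin m → ℝ) (f : X → ℝ) : ℝ :=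
  (∑ s, (hinge (y s) (f (z s)) + reg lam (f (z s)))) / m

/-- The gradient, with respect to the weight vector of neuron `l` of gate `j`, of
`W ↦ sampleLoss lam z y (avgPool ∘ block W V)`, computed by the chain rule (backpropagation).
The derivatives of the scalar functions `hinge`, `reg`, `hardTanh`, `relu` at their kinks are `0`,
which is the value of `deriv` there: the sub-gradient zero is taken at the kinks. -/
def sampleGrad {m k i : ℕ} (lam : ℝ) (z : Fin m → Fin (2 ^ (i + 1)) → ℝ) (y : Fin m → ℝ)
    (V : Fin (2 ^ i) → Fin k → ℝ) (W : Fin (2 ^ i) → Fin k → ℝ × ℝ)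
    (j : Fin (2 ^ i)) (l : Fin k) : ℝ × ℝ :=
  let c : Fin m → ℝ := fun s =>
    (deriv (hinge (y s)) (avgPool (block W V (z s)))
        + deriv (reg lam) (avgPool (block W V (z s))))
      * ((deriv hardTanh (preact (W j) (V j) (pair (z s) j))
        * (V j l * deriv relu (dot (W j l) (pair (z s) j)))) / (2 ^ i : ℕ))
  ((∑ s, c s * (pair (z s) j).1) / m, (∑ s, c s * (pair (z s) j).2) / m)

/-- One step of gradient descent on the first-layer weights of a block. -/
def gdStep {m k i : ℕ} (η lam : ℝ) (z : Fin m → Fin (2 ^ (i + 1)) → ℝ) (y : Fin m → ℝ)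
    (V : Fin (2 ^ i) → Fin k → ℝ) (W : Fin (2 ^ i) → Fin k → ℝ × ℝ) :
    Fin (2 ^ i) → Fin k → ℝ × ℝ :=
  fun j l => ((W j l).1 - η * (sampleGrad lam z y V W j l).1,
    (W j l).2 - η * (sampleGrad lam z y V W j l).2)

/-! ## Layerwise gradient descent -/

/-- The hidden neurons of the network of depth `d` and width `k`: level, gate, and neuron. -/
abbrev Neuron (d k : ℕ) : Type := (Σ i : Fin d, Fin (2 ^ (i : ℕ))) × Fin k

/-- Initial values of the weights `w ∈ ℝ²` and the (fixed) second-layer weights `v ∈ {±1}`. -/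
abbrev Init (d k : ℕ) : Type := Neuron d k → (ℝ × ℝ) × Bool

/-- The initial first-layer weights of level `i`. -/
def Init.W {d k : ℕ} (θ : Init d k) (i : Fin d) : Fin (2 ^ (i : ℕ)) → Fin k → ℝ × ℝ :=
  fun j l => (θ (⟨i, j⟩, l)).1

/-- The second-layer weights of level `i`. -/
def Init.V {d k : ℕ} (θ : Init d k) (i : Fin d) : Fin (2 ^ (i : ℕ)) → Fin k → ℝ :=
  fun j l => sgn (θ (⟨i, j⟩, l)).2

/-- A labelled sample of size `m`. -/
abbrev Sample (d m : ℕ) : Type := Fin m → (Fin (2 ^ d) → Bool) × Bool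

/-- The input vectors of the sample. -/
def Sample.x {d m : ℕ} (S : Sample d m) : Fin m → Fin (2 ^ d) → ℝ := fun s t => sgn ((S s).1 t)

/-- The labels of the sample. -/
def Sample.y {d m : ℕ} (S : Sample d m) : Fin m → ℝ := fun s => sgn (S s).2

/-- The remaining passes of the outer loop of the algorithm, when the network `N` from the inputs
to level `i` has been trained: the block below level `i` is trained by `T` steps of gradient descent
on the loss of the average pooling of its output, and is then put on top of `N`. -/
def trainFrom {d k m : ℕ} (T : ℕ) (η lam : ℝ) (S : Sample d m) (θ : Init d k) :
    (i : ℕ) → i ≤ d → ((Fin (2 ^ d) → ℝ) → Fin (2 ^ i) → ℝ) → (Fin (2 ^ d) → ℝ) → ℝ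
  | 0, _, N => fun x => N x 0
  | i + 1, h, N =>
    let V := θ.V ⟨i, h⟩
    let W := (gdStep η lam (fun s => N (S.x s)) S.y V)^[T] (θ.W ⟨i, h⟩)
    trainFrom T η lam S θ i (Nat.le_of_succ_le h) fun x => block W V (N x)

/-- The network returned by layerwise gradient descent on the sample `S`, with `T` iterations
per layer, learning rate `η`, regularization `lam` and initialization `θ`. -/
def layerwiseGD {d k m : ℕ} (T : ℕ) (η lam : ℝ) (S : Sample d m) (θ : Init d k) :
    (Fin (2 ^ d) → ℝ) → ℝ :=
  trainFrom T η lam S θ d le_rfl id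

/-! ## Running time

The algorithm again, as a program on a unit-cost real random access machine: each arithmetic
operation or comparison on real numbers, each iteration of a loop and each written array
entry costs one step. -/

/-- A value together with the number of steps spent on computing it. -/
structure Timed (α : Type) where
  val : α
  steps : ℕ

namespace Timed

variable {α β : Type}

instance : Monad Timed where
  pure a := ⟨a, 0⟩
  bind x f := ⟨(f x.val).val, x.steps + (f x.val).steps⟩

@[simp] theorem val_pure (a : α) : (pure a : Timed α).val = a := rfl
@[simp] theorem steps_pure (a : α) : (pure a : Timed α).steps = 0 := rfl
@[simp] theorem val_bind (x : Timed α) (f : α → Timed β) : (x >>= f).val = (f x.val).val := rfl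
@[simp] theorem steps_bind (x : Timed α) (f : α → Timed β) :
    (x >>= f).steps = x.steps + (f x.val).steps := rfl

def add (a b : ℝ) : Timed ℝ := ⟨a + b, 1⟩
def sub (a b : ℝ) : Timed ℝ := ⟨a - b, 1⟩
def mul (a b : ℝ) : Timed ℝ := ⟨a * b, 1⟩
def div (a b : ℝ) : Timed ℝ := ⟨a / b, 1⟩

open scoped Classical in
/-- Compare `a` and `b`, and continue with `p` if `a < b` and with `q` otherwise. -/
def ifLT (a b : ℝ) (p q : Timed α) : Timed α :=
  if a < b then ⟨p.val, p.steps + 1⟩ else ⟨q.val, q.steps + 1⟩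

/-- Fill an array of length `n`. -/
def array {n : ℕ} (f : Fin n → Timed α) : Timed (Fin n → α) :=
  ⟨fun i => (f i).val, ∑ i, ((f i).steps + 1)⟩

/-- Accumulate a sum in a loop of length `n`; an iteration costs one addition and one loop step. -/
def sum {n : ℕ} (f : Fin n → Timed ℝ) : Timed ℝ :=
  ⟨∑ i, (f i).val, ∑ i, ((f i).steps + 2)⟩

/-- Repeat `f` for `T` times. -/
def loop (f : α → Timed α) : ℕ → α → Timed α
  | 0, a => pure a
  | T + 1, a => do
    let b ← f a
    let c ← loop f T b
    ⟨c, 1⟩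

end Timed

open Timed

def reluT (z : ℝ) : Timed ℝ := ifLT 0 z (pure z) (pure 0)

def hardTanhT (z : ℝ) : Timed ℝ := ifLT 1 z (pure 1) (ifLT z (-1) (pure (-1)) (pure z))

def dReluT (z : ℝ) : Timed ℝ := ifLT 0 z (pure 1) (pure 0)

def dHardTanhT (z : ℝ) : Timed ℝ := ifLT (-1) z (ifLT z 1 (pure 1) (pure 0)) (pure 0)

def dHingeT (y p : ℝ) : Timed ℝ := do
  let a ← mul y p
  ifLT a 1 (sub 0 y) (pure 0)

def dRegT (lam p : ℝ) : Timed ℝ := ifLT p 1 (sub 0 lam) (ifLT 1 p (pure lam) (pure 0))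

def dotT (w x : ℝ × ℝ) : Timed ℝ := do
  let a ← mul w.1 x.1
  let b ← mul w.2 x.2
  add a b

def preactT {k : ℕ} (w : Fin k → ℝ × ℝ) (v : Fin k → ℝ) (x : ℝ × ℝ) : Timed ℝ :=
  Timed.sum fun l => do
    let a ← dotT (w l) x
    let r ← reluT a
    mul (v l) r

def blockT {k i : ℕ} (W : Fin (2 ^ i) → Fin k → ℝ × ℝ) (V : Fin (2 ^ i) → Fin k → ℝ)
    (x : Fin (2 ^ (i + 1)) → ℝ) : Timed (Fin (2 ^ i) → ℝ) :=
  array fun j => do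
    let h ← preactT (W j) (V j) (pair x j)
    hardTanhT h

def avgPoolT {n : ℕ} (x : Fin n → ℝ) : Timed ℝ := do
  let a ← Timed.sum fun j => pure (x j)
  div a n

/-- The derivative of the loss with respect to the pooled prediction, for one example. -/
def outGradT {k i : ℕ} (lam : ℝ) (V : Fin (2 ^ i) → Fin k → ℝ) (W : Fin (2 ^ i) → Fin k → ℝ × ℝ)
    (z : Fin (2 ^ (i + 1)) → ℝ) (y : ℝ) : Timed ℝ := do
  let o ← blockT W V z
  let p ← avgPoolT o
  let a ← dHingeT y p
  let b ← dRegT lam p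
  add a b

/-- The contribution of one example to the gradient of neuron `l` of gate `j`, without the last
factor `x`; `e` is the derivative of the loss with respect to the pooled prediction. -/
def coeffT {k i : ℕ} (V : Fin (2 ^ i) → Fin k → ℝ) (W : Fin (2 ^ i) → Fin k → ℝ × ℝ)
    (z : Fin (2 ^ (i + 1)) → ℝ) (e : ℝ) (j : Fin (2 ^ i)) (l : Fin k) : Timed ℝ := do
  let h ← preactT (W j) (V j) (pair z j)
  let dh ← dHardTanhT h
  let a ← dotT (W j l) (pair z j)
  let da ← dReluT a
  let u ← mul (V j l) da
  let t ← mul dh u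
  let r ← div t (2 ^ i : ℕ)
  mul e r

def gdStepT {m k i : ℕ} (η lam : ℝ) (z : Fin m → Fin (2 ^ (i + 1)) → ℝ) (y : Fin m → ℝ)
    (V : Fin (2 ^ i) → Fin k → ℝ) (W : Fin (2 ^ i) → Fin k → ℝ × ℝ) :
    Timed (Fin (2 ^ i) → Fin k → ℝ × ℝ) := do
  let e ← array fun s => outGradT lam V W (z s) (y s)
  array fun j => array fun l => do
    let c ← array fun s => coeffT V W (z s) (e s) j l
    let a ← Timed.sum fun s => mul (c s) (pair (z s) j).1
    let a' ← div a m
    let a'' ← mul η a'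
    let w ← sub (W j l).1 a''
    let b ← Timed.sum fun s => mul (c s) (pair (z s) j).2
    let b' ← div b m
    let b'' ← mul η b'
    let w' ← sub (W j l).2 b''
    pure (w, w')

/-- The outer loop; `z s` is the stored value at level `i` of the trained network `N` on the `s`-th
example. The network is carried along as a description made of the trained weights. -/
def trainFromT {d k m : ℕ} (T : ℕ) (η lam : ℝ) (S : Sample d m) (θ : Init d k) :
    (i : ℕ) → i ≤ d → ((Fin (2 ^ d) → ℝ) → Fin (2 ^ i) → ℝ) → (Fin m → Fin (2 ^ i) → ℝ) →
      Timed ((Fin (2 ^ d) → ℝ) → ℝ)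
  | 0, _, N, _ => ⟨fun x => N x 0, 1⟩
  | i + 1, h, N, z => do
    let V ← array fun j => array fun l => pure (θ.V ⟨i, h⟩ j l)
    let W₀ ← array fun j => array fun l => pure (θ.W ⟨i, h⟩ j l)
    let W ← loop (gdStepT η lam z S.y V) T W₀
    let z' ← array fun s => blockT W V (z s)
    trainFromT T η lam S θ i (Nat.le_of_succ_le h) (fun x => block W V (N x)) z'

/-- Layerwise gradient descent with its number of steps. -/
def layerwiseGDT {d k m : ℕ} (T : ℕ) (η lam : ℝ) (S : Sample d m) (θ : Init d k) :
    Timed ((Fin (2 ^ d) → ℝ) → ℝ) := do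
  let z ← array fun s => array fun t => pure (S.x s t)
  trainFromT T η lam S θ d le_rfl id z

/-! The program computes what it should. -/

theorem relu_eq (z : ℝ) : relu z = (z + |z|) / 2 := by
  unfold relu
  rcases le_total 0 z with h | h
  · rw [max_eq_left h, abs_of_nonneg h]; ring
  · rw [max_eq_right h, abs_of_nonpos h]; ring

theorem deriv_relu (z : ℝ) : deriv relu z = if 0 < z then 1 else 0 := by
  rcases lt_trichotomy z 0 with h | h | h
  · rw [if_neg h.le.not_gt]
    have : relu =ᶠ[nhds z] fun _ => 0 := by
      filter_upwards [Iio_mem_nhds h] with x hx using max_eq_right (le_of_lt hx)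
    rw [this.deriv_eq, deriv_const]
  · subst h
    rw [if_neg (lt_irrefl _)]
    apply deriv_zero_of_not_differentiableAt
    intro hd
    apply not_differentiableAt_abs_zero
    have : (abs : ℝ → ℝ) = fun x => 2 * relu x - x := by
      funext x; rw [relu_eq]; ring
    rw [this]
    exact (hd.const_mul 2).sub differentiableAt_id
  · rw [if_pos h]
    have : relu =ᶠ[nhds z] fun x => x := by
      filter_upwards [Ioi_mem_nhds h] with x hx using max_eq_left (le_of_lt hx)
    rw [this.deriv_eq, deriv_id'']

theorem deriv_hinge (y p : ℝ) : deriv (hinge y) p = if y * p < 1 then -y else 0 := by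
  have e : hinge y = fun x => relu (1 - y * x) := rfl
  rcases lt_trichotomy (y * p) 1 with h | h | h
  · rw [if_pos h]
    have hc : ContinuousAt (fun x : ℝ => y * x) p := by fun_prop
    have : hinge y =ᶠ[nhds p] fun x => 1 - y * x := by
      filter_upwards [hc.eventually_lt_const h] with x hx
      exact max_eq_left (by linarith)
    rw [this.deriv_eq]
    simp
  · rw [if_neg (by linarith)]
    apply deriv_zero_of_not_differentiableAt
    intro hd
    have hy : y ≠ 0 := by rintro rfl; simp at h
    apply not_differentiableAt_abs_zero
    have h1 : DifferentiableAt ℝ (fun t : ℝ => hinge y ((1 - t) / y)) 0 := by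
      have hp : (1 - (0 : ℝ)) / y = p := by field_simp; linarith
      refine DifferentiableAt.comp (g := hinge y) (0 : ℝ) ?_ ?_
      · rw [hp]; exact hd
      · fun_prop
    have h2 : (abs : ℝ → ℝ) = fun t => 2 * hinge y ((1 - t) / y) - t := by
      funext t
      have : 1 - y * ((1 - t) / y) = t := by field_simp; ring
      simp only [e, this, relu_eq]
      ring
    rw [h2]
    exact (h1.const_mul 2).sub differentiableAt_id
  · rw [if_neg (by linarith)]
    have hc : ContinuousAt (fun x : ℝ => y * x) p := by fun_prop
    have : hinge y =ᶠ[nhds p] fun _ => 0 := by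
      filter_upwards [hc.eventually_const_lt h] with x hx
      exact max_eq_right (by linarith)
    rw [this.deriv_eq, deriv_const]

theorem deriv_reg (lam p : ℝ) :
    deriv (reg lam) p = if p < 1 then -lam else if 1 < p then lam else 0 := by
  have h : deriv (reg lam) p = lam * -deriv (fun x : ℝ => |x|) (1 - p) := by
    have : reg lam = fun x => lam * (fun t : ℝ => |t|) (1 - x) := rfl
    rw [this, deriv_const_mul_field, deriv_comp_const_sub]
  rw [h]
  rcases lt_trichotomy p 1 with h | h | h
  · rw [if_pos h, (hasDerivAt_abs_pos (by linarith)).deriv]; ring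
  · subst h
    rw [sub_self, deriv_abs_zero]; simp
  · rw [if_neg (by linarith), if_pos h, (hasDerivAt_abs_neg (by linarith)).deriv]; ring

theorem deriv_hardTanh (z : ℝ) :
    deriv hardTanh z = if -1 < z then (if z < 1 then 1 else 0) else 0 := by
  by_cases h1 : -1 < z
  · rw [if_pos h1]
    have : hardTanh =ᶠ[nhds z] fun x => 1 - hinge 1 x := by
      filter_upwards [Ioi_mem_nhds h1] with x hx
      have hx : -1 < x := hx
      unfold hardTanh hinge
      rcases le_total x 1 with h | h
      · rw [min_eq_left h, max_eq_left hx.le, max_eq_left (by linarith)]; ring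
      · rw [min_eq_right h, max_eq_left (by norm_num), max_eq_right (by linarith)]; ring
    rw [this.deriv_eq, deriv_const_sub, deriv_hinge]
    simp only [one_mul]
    split_ifs <;> simp
  · rw [if_neg h1]
    have : hardTanh =ᶠ[nhds z] fun x => relu (x + 1) - 1 := by
      filter_upwards [Iio_mem_nhds (show z < 1 by linarith)] with x hx
      have hx : x < 1 := hx
      unfold hardTanh relu
      rw [min_eq_left hx.le]
      rcases le_total x (-1) with h | h
      · rw [max_eq_right h, max_eq_right (by linarith)]; ring
      · rw [max_eq_left h, max_eq_left (by linarith)]; ring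
    rw [this.deriv_eq, deriv_sub_const, deriv_comp_add_const, deriv_relu,
      if_neg (by linarith)]

theorem reluT_val (z : ℝ) : (reluT z).val = relu z := by
  unfold reluT ifLT relu
  split_ifs with h
  · simp [h.le]
  · simp [not_lt.mp h]

theorem hardTanhT_val (z : ℝ) : (hardTanhT z).val = hardTanh z := by
  unfold hardTanhT ifLT hardTanh
  split_ifs with h h'
  · simp [h.le]
  · have : z ≤ 1 := by linarith
    simp [this, h'.le]
  · have h1 : z ≤ 1 := not_lt.mp h
    have h2 : -1 ≤ z := not_lt.mp h'
    simp [h1, h2]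

theorem preactT_val {k : ℕ} (w : Fin k → ℝ × ℝ) (v : Fin k → ℝ) (x : ℝ × ℝ) :
    (preactT w v x).val = preact w v x := by
  unfold preactT preact Timed.sum
  simp only [val_bind, reluT_val, Timed.mul, dotT, Timed.add, dot]

theorem blockT_val {k i : ℕ} (W : Fin (2 ^ i) → Fin k → ℝ × ℝ) (V : Fin (2 ^ i) → Fin k → ℝ)
    (x : Fin (2 ^ (i + 1)) → ℝ) : (blockT W V x).val = block W V x := by
  unfold blockT array
  simp only [val_bind, preactT_val, hardTanhT_val]
  rfl

theorem outGradT_val {k i : ℕ} (lam : ℝ) (V : Fin (2 ^ i) → Fin k → ℝ)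
    (W : Fin (2 ^ i) → Fin k → ℝ × ℝ) (z : Fin (2 ^ (i + 1)) → ℝ) (y : ℝ) :
    (outGradT lam V W z y).val =
      deriv (hinge y) (avgPool (block W V z)) + deriv (reg lam) (avgPool (block W V z)) := by
  have hp (x : Fin (2 ^ i) → ℝ) : (avgPoolT x).val = avgPool x := rfl
  unfold outGradT
  simp only [val_bind, blockT_val, hp, deriv_hinge, deriv_reg, Timed.add]
  congr 1
  · simp only [dHingeT, ifLT, val_bind, Timed.mul, Timed.sub]
    split_ifs <;> simp
  · simp only [dRegT, ifLT, Timed.sub]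
    split_ifs <;> simp

theorem coeffT_val {k i : ℕ} (V : Fin (2 ^ i) → Fin k → ℝ) (W : Fin (2 ^ i) → Fin k → ℝ × ℝ)
    (z : Fin (2 ^ (i + 1)) → ℝ) (e : ℝ) (j : Fin (2 ^ i)) (l : Fin k) :
    (coeffT V W z e j l).val =
      e * ((deriv hardTanh (preact (W j) (V j) (pair z j))
        * (V j l * deriv relu (dot (W j l) (pair z j)))) / (2 ^ i : ℕ)) := by
  have h1 (a : ℝ) : (dHardTanhT a).val = deriv hardTanh a := by
    rw [deriv_hardTanh]; unfold dHardTanhT ifLT; split_ifs <;> rfl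
  have h2 (a : ℝ) : (dReluT a).val = deriv relu a := by
    rw [deriv_relu]; unfold dReluT ifLT; split_ifs <;> rfl
  have h3 (w x : ℝ × ℝ) : (dotT w x).val = dot w x := rfl
  unfold coeffT
  simp only [val_bind, preactT_val, h1, h2, h3, Timed.mul, Timed.div]

theorem gdStepT_val {m k i : ℕ} (η lam : ℝ) (z : Fin m → Fin (2 ^ (i + 1)) → ℝ) (y : Fin m → ℝ)
    (V : Fin (2 ^ i) → Fin k → ℝ) (W : Fin (2 ^ i) → Fin k → ℝ × ℝ) :
    (gdStepT η lam z y V W).val = gdStep η lam z y V W := by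
  unfold gdStepT gdStep sampleGrad
  simp only [val_bind, array, outGradT_val, coeffT_val, Timed.sum, Timed.mul, Timed.div,
    Timed.sub, val_pure]

theorem loop_val {α : Type} (f : α → Timed α) (T : ℕ) (a : α) :
    (loop f T a).val = (fun b => (f b).val)^[T] a := by
  induction T generalizing a with
  | zero => rfl
  | succ T ih => exact ih _

theorem trainFromT_val {d k m : ℕ} (T : ℕ) (η lam : ℝ) (S : Sample d m) (θ : Init d k) (i : ℕ)
    (h : i ≤ d) (N : (Fin (2 ^ d) → ℝ) → Fin (2 ^ i) → ℝ) :
    (trainFromT T η lam S θ i h N fun s => N (S.x s)).val = trainFrom T η lam S θ i h N := by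
  induction i with
  | zero => rfl
  | succ i ih =>
    unfold trainFromT trainFrom
    simp only [val_bind, array, val_pure, loop_val, gdStepT_val, blockT_val]
    exact ih _ _

/-- The program returns the network of layerwise gradient descent. -/
theorem layerwiseGDT_val {d k m : ℕ} (T : ℕ) (η lam : ℝ) (S : Sample d m) (θ : Init d k) :
    (layerwiseGDT T η lam S θ).val = layerwiseGD T η lam S θ :=
  trainFromT_val T η lam S θ d le_rfl id

/-! ## The setting of the learning guarantee -/

/-- A law of the initial weights `w ∈ ℝ²` of a neuron with entries bounded by `B`, for which
`⟨w, p⟩` is positive with probability one half for every pattern `p ∈ {±1}²`. (An example is the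
uniform law on `[-B, B]²`.) -/
structure IsInitLaw (B : ℝ) (μ : Measure (ℝ × ℝ)) : Prop where
  prob : IsProbabilityMeasure μ
  bound : ∀ᵐ w ∂μ, |w.1| ≤ B ∧ |w.2| ≤ B
  half : ∀ p : Bool × Bool, μ {w | 0 < dot w (sgn p.1, sgn p.2)} = 1 / 2

/-- The joint law of an i.i.d. sample of size `m` from the generative distribution of `C` and, independently,
an initialization where the neurons are independent, `w ∼ μ` and `v` is uniform on `{±1}`. -/
def Circuit.law {d : ℕ} (C : Circuit d) (k m : ℕ) (μ : Measure (ℝ × ℝ)) :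
    Measure (Sample d m × Init d k) :=
  (Measure.pi fun _ : Fin m => C.dist.toMeasure).prod
    (Measure.pi fun _ : Neuron d k => μ.prod (PMF.uniformOfFintype Bool).toMeasure)

/-- The correlation margin `Δ = (2/3)^d`. -/
def margin (d : ℕ) : ℝ := (2 / 3) ^ d

/-- The lower bound `ε = 4^{-d}` for pattern probabilities. -/
def patProb (d : ℕ) : ℝ := (1 / 4) ^ d

/-- The conditions on width `k`, sample size `m`, learning rate `η` and number `T` of iterations
per layer, for `n = 2 ^ d` inputs and confidence `1 - δ`. -/
structure Admissible (d : ℕ) (δ : ℝ) (k m T : ℕ) (η : ℝ) : Prop where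
  width : (Real.log (4 / 3))⁻¹ * Real.log (2 * 2 ^ d * d / δ) ≤ k
  rate_pos : 0 < η
  rate : η ≤ 1 / (16 * √2 * k)
  sample : 2 ^ 11 / (patProb d ^ 2 * margin d ^ 2) * Real.log (8 * 2 ^ d * d / δ) < m
  iter : 6 * 2 ^ d / (√2 * η * patProb d * margin d) < T

end TreeLearn

end

open MeasureTheory

noncomputable section

namespace TreeLearn

/-! ## Dynamics of a single gate -/

/-! The gates of a block do not interact. If a gate is unsaturated, its output lies in `(-1, 1)`,
hence so does the pooled average, where the loss has slope exactly `-(y + λ)`; if it is saturated,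
its gradient is zero (`deriv_loss_mul`). When its inputs are `±1`, each gate therefore moves
autonomously, driven by four numbers: the empirical means of `y + λ` on its four input patterns
(`gdStep_eq_gateStep`).

Within a gate, patterns that are neither equal nor antipodal are orthogonal, so the motion splits
along two axes. A neuron active on `p` whose output weight has the sign of the pattern's mean only
grows, neurons of the other sign stay small, and the output on `p` saturates at that sign. Few steps
can be unsaturated at `p` or at its antipode, and once both are saturated the axis is frozen
(`saturation`, `neuralGate_iterate_gateStep`).

The signs come from the generative model. Every gate type transmits correlation with the label by a
factor `±2/3` per level, so a node of level `i` has correlation `±(2/3)^i`. The mean of `y + λ` on a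
pattern then has the sign of the gate output times the orientation of the node, with margin `Δ/6`
(`margin_le_patternWeight`). A trained gate thus computes its node exactly, up to a fixed negation;
siblings share their negation, and the root has none. Evaluating one level turns the distribution at
its inputs into the one at its outputs (`map_layer_gen`), which allows an induction over levels
(`layer_trained`, `trainFrom_eq`).

The good events refer only to values of the true circuit and to fixed target signs, so the sample
can be reused on every level: Hoeffding's inequality and a union bound cover the sample, and another
union bound the initialization. The polynomial bounds come from counting steps and from choosing
parameters close to their thresholds. -/

theorem sgn_sq (b : Bool) : sgn b * sgn b = 1 := by cases b <;> simp [sgn]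

theorem sgn_eq_or (b : Bool) : sgn b = 1 ∨ sgn b = -1 := by cases b <;> simp [sgn]

theorem sgn_not (b : Bool) : sgn (!b) = -sgn b := by cases b <;> simp [sgn]

theorem abs_sgn (b : Bool) : |sgn b| = 1 := by cases b <;> simp [sgn]

/-- The point of `{±1}²` encoded by a pattern. -/
def pt (p : Bool × Bool) : ℝ × ℝ := (sgn p.1, sgn p.2)

/-- The antipodal pattern. -/
def anti (p : Bool × Bool) : Bool × Bool := (!p.1, !p.2)

theorem dot_anti (w : ℝ × ℝ) (p : Bool × Bool) : dot w (pt (anti p)) = -dot w (pt p) := by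
  simp only [dot, pt, anti, sgn_not]; ring

/-- One step of gradient descent on a single gate, for the aggregated label weights `F p` of the
four patterns. -/
def gateStep {k : ℕ} (c : ℝ) (F : Bool × Bool → ℝ) (v : Fin k → ℝ) (w : Fin k → ℝ × ℝ) :
    Fin k → ℝ × ℝ := fun l =>
  ((w l).1 + ∑ p, c * (F p * (deriv hardTanh (preact w v (pt p)) *
      (v l * deriv relu (dot (w l) (pt p))))) * (pt p).1,
   (w l).2 + ∑ p, c * (F p * (deriv hardTanh (preact w v (pt p)) *
      (v l * deriv relu (dot (w l) (pt p))))) * (pt p).2)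

/-- Of the four patterns only `p` and `anti p` contribute: the other two are orthogonal to `p`. The
factor 2 is the squared norm of `p`. -/
theorem dot_gateStep {k : ℕ} (c : ℝ) (F : Bool × Bool → ℝ) (v : Fin k → ℝ) (w : Fin k → ℝ × ℝ)
    (l : Fin k) (p : Bool × Bool) :
    dot (gateStep c F v w l) (pt p) = dot (w l) (pt p) + 2 * c * v l *
      (F p * deriv hardTanh (preact w v (pt p)) * deriv relu (dot (w l) (pt p)) -
        F (anti p) * deriv hardTanh (preact w v (pt (anti p))) *
          deriv relu (-dot (w l) (pt p))) := by
  rw [← dot_anti]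
  set R : Bool × Bool → ℝ := fun p => deriv relu (dot (w l) (pt p)) with hR
  have hR' (p) : deriv relu (dot (w l) (pt p)) = R p := rfl
  set H : Bool × Bool → ℝ := fun p => deriv hardTanh (preact w v (pt p)) with hH
  have hH' (p) : deriv hardTanh (preact w v (pt p)) = H p := rfl
  simp only [gateStep, hR', hH']
  clear_value R H
  rcases p with ⟨a, b⟩
  cases a <;> cases b <;>
    simp [dot, pt, anti, sgn, Fintype.sum_prod_type] <;> ring

/-! ### Motion along one antipodal axis -/

/-- The outputs of a gate on antipodal patterns depend on the signed projections `a l` only. -/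
def axisOut {k : ℕ} (v a : Fin k → ℝ) : ℝ := ∑ l, v l * relu (a l)

theorem deriv_hardTanh_eq_one_or {h : ℝ} :
    (deriv hardTanh h = 1 ∧ -1 < h ∧ h < 1) ∨ (deriv hardTanh h = 0 ∧ (h ≤ -1 ∨ 1 ≤ h)) := by
  rw [deriv_hardTanh]
  split_ifs with h1 h2
  · exact Or.inl ⟨rfl, h1, h2⟩
  · exact Or.inr ⟨rfl, Or.inr (not_lt.mp h2)⟩
  · exact Or.inr ⟨rfl, Or.inl (not_lt.mp h1)⟩

/-- The motion of the signed projections `a t l = ⟨w l, p⟩` under gradient descent. -/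
structure IsAxisMotion {k : ℕ} (c F F' : ℝ) (v : Fin k → ℝ) (a : ℕ → Fin k → ℝ) : Prop where
  step : ∀ t l, a (t + 1) l = a t l + 2 * c * v l *
    (F * deriv hardTanh (axisOut v (a t)) * deriv relu (a t l) -
      F' * deriv hardTanh (axisOut v (-a t)) * deriv relu (-a t l))

namespace IsAxisMotion

variable {k : ℕ} {c F F' : ℝ} {v : Fin k → ℝ} {a : ℕ → Fin k → ℝ}

theorem neg (h : IsAxisMotion c F F' v a) : IsAxisMotion c F' F v (-a) where
  step t l := by
    have := h.step t l
    simp only [Pi.neg_apply, this, neg_neg]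
    ring

/-- A neuron of the wrong sign is never pushed up while it is active. From a negative value one step
lifts it by at most `2 * c * |F'|`, and at zero both derivatives of `relu` vanish, so it rests
there. -/
theorem relu_le_of_wrong (h : IsAxisMotion c F F' v a) {M : ℝ} {l : Fin k} (hc : 0 ≤ c)
    (hv : v l * v l = 1) (hwrong : v l * F ≤ 0) (hF' : 2 * c * |F'| ≤ M) (h0 : a 0 l ≤ M) (t : ℕ) :
    a t l ≤ M := by
  induction t with
  | zero => exact h0
  | succ t ih =>
    have hM : 0 ≤ M := le_trans (by positivity) hF'
    rw [h.step t l]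
    simp only [deriv_relu]
    have hd1 : 0 ≤ deriv hardTanh (axisOut v (a t)) := by
      rcases deriv_hardTanh_eq_one_or (h := axisOut v (a t)) with ⟨e, -⟩ | ⟨e, -⟩ <;> simp [e]
    have hv1 : |v l| = 1 := by
      rw [← sq_eq_sq₀ (abs_nonneg _) zero_le_one, sq_abs, sq, hv, one_pow]
    rcases lt_trichotomy (a t l) 0 with ha | ha | ha
    · rw [if_neg ha.le.not_gt, if_pos (by linarith)]
      have : -(2 * c * (v l * F' * deriv hardTanh (axisOut v (-a t)))) ≤ 2 * c * |F'| := by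
        rw [← mul_neg]
        refine mul_le_mul_of_nonneg_left ?_ (by linarith)
        refine (neg_le_abs _).trans ?_
        rw [abs_mul, abs_mul, hv1, one_mul]
        rcases deriv_hardTanh_eq_one_or (h := axisOut v (-a t)) with ⟨e, -⟩ | ⟨e, -⟩ <;>
          simp [e]
      linarith
    · simp [ha, hM]
    · rw [if_pos ha, if_neg (by linarith)]
      have : 0 ≤ c * -(v l * F) * deriv hardTanh (axisOut v (a t)) := by
        have : 0 ≤ -(v l * F) := by linarith
        positivity
      linarith

theorem right_succ (h : IsAxisMotion c F F' v a) {s : ℝ} {l : Fin k}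
    (hv : v l = s) {t : ℕ} (ha : 0 < a t l) :
    a (t + 1) l = a t l + 2 * c * (s * F) * deriv hardTanh (axisOut v (a t)) := by
  rw [h.step, deriv_relu, deriv_relu, if_pos ha, if_neg (by linarith), hv]; ring

/-- Each unsaturated step moves an active neuron of the right sign by the same positive amount, so
its displacement counts those steps. -/
theorem right_eq_sum (h : IsAxisMotion c F F' v a) {s : ℝ} {l : Fin k}
    (hv : v l = s) (hc : 0 ≤ c) (hF : 0 ≤ s * F) (ha : 0 < a 0 l) (t : ℕ) :
    0 < a t l ∧ a t l = a 0 l + 2 * c * (s * F) *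
      ∑ r ∈ Finset.range t, deriv hardTanh (axisOut v (a r)) := by
  induction t with
  | zero => simpa using ha
  | succ t ih =>
    have hd1 : 0 ≤ deriv hardTanh (axisOut v (a t)) := by
      rcases deriv_hardTanh_eq_one_or (h := axisOut v (a t)) with ⟨e, -⟩ | ⟨e, -⟩ <;> simp [e]
    have e := h.right_succ hv ih.1
    refine ⟨?_, ?_⟩
    · rw [e]
      have : 0 ≤ 2 * c * (s * F) * deriv hardTanh (axisOut v (a t)) := by positivity
      linarith [ih.1]
    · rw [e, Finset.sum_range_succ, mul_add, ← add_assoc, ← ih.2]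

/-- Neurons of the right sign contribute nonnegatively and the others at least `-M`. For a neat
total, `M` is also given away at `l₀`. -/
theorem le_axisOut {s : ℝ} {l₀ : Fin k} {b : Fin k → ℝ} {M : ℝ} (hs : s * s = 1)
    (hv : ∀ l, v l = s ∨ v l = -s) (hl : v l₀ = s) (hM : 0 ≤ M)
    (hb : ∀ l, v l = -s → b l ≤ M) : b l₀ - k * M ≤ s * axisOut v b := by
  have hr (x : ℝ) : 0 ≤ relu x := le_max_right _ _
  have h1 (l : Fin k) : -M ≤ s * (v l * relu (b l)) := by
    rcases hv l with e | e
    · rw [e, ← mul_assoc, hs]; linarith [hr (b l)]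
    · rw [e, ← mul_assoc, mul_neg, hs]
      have : relu (b l) ≤ M := max_le (hb l e) hM
      linarith
  have h2 : ∑ l, (if l = l₀ then b l₀ - M else -M) ≤ s * axisOut v b := by
    rw [axisOut, Finset.mul_sum]
    refine Finset.sum_le_sum fun l _ => ?_
    split_ifs with e
    · subst e
      rw [hl, ← mul_assoc, hs, one_mul]
      have : b l ≤ relu (b l) := le_max_left _ _
      linarith
    · exact h1 l
  have h3 : ∑ l, (if l = l₀ then b l₀ - M else -M) = b l₀ - k * M := by
    have : ∀ l, (if l = l₀ then b l₀ - M else -M) = (if l = l₀ then b l₀ else 0) + -M := by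
      intro l; split_ifs <;> ring
    simp [this, Finset.sum_add_distrib]
    ring
  linarith

/-- The number of steps at which the gate is not saturated is bounded, and saturation is
at the correct end. -/
theorem saturation (h : IsAxisMotion c F F' v a) {s f : ℝ} {l₀ : Fin k} {M : ℝ} (hs : s * s = 1)
    (hv : ∀ l, v l = s ∨ v l = -s) (hl : v l₀ = s) (hc : 0 < c) (hf : 0 < f) (hF : f ≤ s * F)
    (hFM : 2 * c * |F| ≤ M) (hF' : 2 * c * |F'| ≤ M) (hM : k * M ≤ 1 / 2)
    (h0 : ∀ l, a 0 l ≤ M) (ha : 0 < a 0 l₀) :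
    (∀ t, deriv hardTanh (axisOut v (a t)) = 0 → 1 ≤ s * axisOut v (a t)) ∧
    ∀ t, c * f * ∑ r ∈ Finset.range t, deriv hardTanh (axisOut v (a r)) ≤ 1 := by
  have hM0 : 0 ≤ M := le_trans (by positivity) hF'
  have hsF : 0 < s * F := hf.trans_le hF
  have hk : (1 : ℝ) ≤ k := by
    have : 0 < k := lt_of_le_of_lt (Nat.zero_le _) l₀.isLt
    exact_mod_cast this
  have hM2 : M ≤ 1 / 2 := by nlinarith
  have hsabs : s * F ≤ |F| := by
    refine (le_abs_self _).trans ?_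
    have : |s| = 1 := by
      rw [← sq_eq_sq₀ (abs_nonneg _) zero_le_one, sq_abs, sq, hs, one_pow]
    rw [abs_mul, this, one_mul]
  have hwrong (t : ℕ) (l : Fin k) (e : v l = -s) : a t l ≤ M := by
    refine h.relu_le_of_wrong hc.le (by rw [e]; linarith) (by rw [e]; linarith) hF' (h0 l) t
  have hlow (t : ℕ) : a t l₀ - 1 / 2 ≤ s * axisOut v (a t) := by
    have := le_axisOut hs hv hl hM0 (hwrong t)
    linarith
  have hright := fun t => h.right_eq_sum hl hc.le hsF.le ha t
  have hsv : s = 1 ∨ s = -1 := mul_self_eq_one_iff.mp hs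
  -- An unsaturated step starts below `3 / 2`, because the signed output is below 1 and at least `a
  -- t l₀ - 1 / 2`. Its length is at most `M ≤ 1 / 2`.
  have hbd (t : ℕ) : a t l₀ ≤ 2 := by
    induction t with
    | zero => linarith [h0 l₀]
    | succ t ih =>
      rw [h.right_succ hl (hright t).1]
      rcases deriv_hardTanh_eq_one_or (h := axisOut v (a t)) with ⟨e, e1, e2⟩ | ⟨e, -⟩
      · rw [e, mul_one]
        have h1 : 2 * c * (s * F) ≤ 2 * c * |F| := by gcongr
        have h2 : s * axisOut v (a t) ≤ 1 := by rcases hsv with rfl | rfl <;> linarith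
        linarith [hlow t]
      · rw [e]; linarith
  refine ⟨fun t e => ?_, fun t => ?_⟩
  · have h1 := hlow t
    have h2 := (hright t).1
    rcases deriv_hardTanh_eq_one_or (h := axisOut v (a t)) with ⟨e', -⟩ | ⟨-, e'⟩
    · rw [e] at e'; norm_num at e'
    -- The signed output exceeds `-1 / 2`, which excludes saturation at the wrong end.
    · rcases hsv with rfl | rfl <;> rcases e' with e' | e' <;> linarith
  · have hsum : 0 ≤ ∑ r ∈ Finset.range t, deriv hardTanh (axisOut v (a r)) := by
      refine Finset.sum_nonneg fun r _ => ?_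
      rcases deriv_hardTanh_eq_one_or (h := axisOut v (a r)) with ⟨e, -⟩ | ⟨e, -⟩ <;> simp [e]
    have h1 := (hright t).2
    have h2 := hbd t
    have h3 : c * f * ∑ r ∈ Finset.range t, deriv hardTanh (axisOut v (a r)) ≤
        c * (s * F) * ∑ r ∈ Finset.range t, deriv hardTanh (axisOut v (a r)) := by gcongr
    linarith

theorem frozen (h : IsAxisMotion c F F' v a) {t : ℕ}
    (h1 : deriv hardTanh (axisOut v (a t)) = 0) (h2 : deriv hardTanh (axisOut v (-a t)) = 0)
    {t' : ℕ} (ht : t ≤ t') : a t' = a t := by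
  induction t', ht using Nat.le_induction with
  | base => rfl
  | succ r _ ih =>
    funext l
    rw [h.step, ih, h1, h2]; ring

/-- Saturation at `p` alone need not last, since updates caused by the antipode can undo it. What is
needed is one step at which both ends are saturated. -/
theorem hardTanh_axisOut (h : IsAxisMotion c F F' v a) {s s' f M : ℝ} {l₀ l₁ : Fin k}
    (hs : s * s = 1) (hs' : s' * s' = 1) (hv : ∀ l, v l * v l = 1)
    (hl : v l₀ = s) (hl' : v l₁ = s') (hc : 0 < c) (hf : 0 < f) (hF : f ≤ s * F)
    (hF' : f ≤ s' * F') (hFM : 2 * c * |F| ≤ M) (hFM' : 2 * c * |F'| ≤ M) (hM : k * M ≤ 1 / 2)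
    (h0 : ∀ l, |a 0 l| ≤ M) (ha : 0 < a 0 l₀) (ha' : a 0 l₁ < 0) {T : ℕ} (hT : 2 < c * f * T) :
    hardTanh (axisOut v (a T)) = s := by
  have hor {s : ℝ} (hs : s * s = 1) (l : Fin k) : v l = s ∨ v l = -s :=
    mul_self_eq_mul_self_iff.mp ((hv l).trans hs.symm)
  obtain ⟨A1, A2⟩ := h.saturation hs (hor hs) hl hc hf hF hFM hFM' hM
    (fun l => (le_abs_self _).trans (h0 l)) ha
  obtain ⟨-, B2⟩ := h.neg.saturation hs' (hor hs') hl' hc hf hF' hFM' hFM hM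
    (fun l => (neg_le_abs _).trans (h0 l)) (by simpa using ha')
  have : ∃ t < T, deriv hardTanh (axisOut v (a t)) = 0 ∧
      deriv hardTanh (axisOut v (-a t)) = 0 := by
    -- Otherwise each of the `T` steps is unsaturated at one of the two ends, while each end allows
    -- at most `1 / (c * f)` such steps.
    by_contra! hcon
    have h1 : (T : ℝ) ≤ ∑ t ∈ Finset.range T, (deriv hardTanh (axisOut v (a t)) +
        deriv hardTanh (axisOut v (-a t))) := by
      have : (T : ℝ) = ∑ t ∈ Finset.range T, 1 := by simp
      rw [this]
      refine Finset.sum_le_sum fun t ht => ?_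
      have := hcon t (Finset.mem_range.mp ht)
      rcases deriv_hardTanh_eq_one_or (h := axisOut v (a t)) with ⟨e, -⟩ | ⟨e, -⟩ <;>
        rcases deriv_hardTanh_eq_one_or (h := axisOut v (-a t)) with ⟨e', -⟩ | ⟨e', -⟩
      · rw [e, e']; norm_num
      · rw [e, e']; norm_num
      · rw [e, e']; norm_num
      · exact absurd e' (this e)
    rw [Finset.sum_add_distrib] at h1
    have h2 := A2 T
    have h3 := B2 T
    have h4 : c * f * T ≤ c * f * (∑ t ∈ Finset.range T, deriv hardTanh (axisOut v (a t)) +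
        ∑ t ∈ Finset.range T, deriv hardTanh (axisOut v (-a t))) := by gcongr
    simp only [Pi.neg_apply] at h3
    linarith
  obtain ⟨t, htT, e1, e2⟩ := this
  rw [h.frozen e1 e2 htT.le]
  have h1 := A1 t e1
  rcases mul_self_eq_one_iff.mp hs with rfl | rfl
  · unfold hardTanh
    rw [min_eq_right (by linarith)]; norm_num
  · unfold hardTanh
    rw [max_eq_right]
    exact (min_le_left _ _).trans (by linarith)

end IsAxisMotion

/-- After sufficiently many steps the gate outputs on every pattern the sign of its label weight. -/
theorem neuralGate_iterate_gateStep {k : ℕ} {c f M : ℝ} {F : Bool × Bool → ℝ} {v : Fin k → ℝ}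
    {w : Fin k → ℝ × ℝ} {s : Bool × Bool → Bool} (hv : ∀ l, v l * v l = 1) (hc : 0 < c)
    (hf : 0 < f) (hF : ∀ p, f ≤ sgn (s p) * F p) (hFM : ∀ p, 2 * c * |F p| ≤ M)
    (hM : k * M ≤ 1 / 2) (h0 : ∀ l p, |dot (w l) (pt p)| ≤ M)
    (hgood : ∀ p, ∃ l, v l = sgn (s p) ∧ 0 < dot (w l) (pt p)) {T : ℕ} (hT : 2 < c * f * T)
    (p : Bool × Bool) : neuralGate ((gateStep c F v)^[T] w) v (pt p) = sgn (s p) := by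
  have hpre (u : Fin k → ℝ × ℝ) (q : Bool × Bool) :
      preact u v (pt q) = axisOut v fun l => dot (u l) (pt q) := rfl
  have hm : IsAxisMotion c (F p) (F (anti p)) v
      fun t l => dot ((gateStep c F v)^[t] w l) (pt p) := by
    constructor
    intro t l
    rw [Function.iterate_succ_apply', dot_gateStep, hpre, hpre]
    simp only [dot_anti]
    rfl
  obtain ⟨l₀, e₀, g₀⟩ := hgood p
  obtain ⟨l₁, e₁, g₁⟩ := hgood (anti p)
  rw [dot_anti] at g₁
  exact hm.hardTanh_axisOut (sgn_sq _) (sgn_sq _) hv e₀ e₁ hc hf (hF p) (hF (anti p)) (hFM p)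
    (hFM _) hM (fun l => h0 l p) g₀ (by simpa using g₁) hT

/-! ## Decoupling of the gates of a block -/

theorem abs_hardTanh_le (z : ℝ) : |hardTanh z| ≤ 1 := by
  unfold hardTanh
  exact abs_le.mpr ⟨le_max_right _ _, max_le (min_le_right _ _) (by norm_num)⟩

theorem abs_avgPool_lt {n : ℕ} {x : Fin n → ℝ} (hx : ∀ j, |x j| ≤ 1) {j : Fin n}
    (hj : |x j| < 1) : |avgPool x| < 1 := by
  have hn : (0 : ℝ) < n := by
    have : 0 < n := lt_of_le_of_lt (Nat.zero_le _) j.isLt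
    exact_mod_cast this
  rw [avgPool, abs_div, abs_of_pos hn, div_lt_one hn]
  calc |∑ j, x j| ≤ ∑ j, |x j| := Finset.abs_sum_le_sum_abs _ _
    _ < ∑ _j : Fin n, (1 : ℝ) := Finset.sum_lt_sum (fun j _ => hx j) ⟨j, Finset.mem_univ j, hj⟩
    _ = n := by simp

/-- One unsaturated gate keeps the average of all outputs strictly inside `(-1, 1)`, away from the
kinks of hinge loss and regularizer; a saturated gate makes both sides zero. This decouples the
gates. -/
theorem deriv_loss_mul {k i : ℕ} (lam : ℝ) (b : Bool) (V : Fin (2 ^ i) → Fin k → ℝ)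
    (W : Fin (2 ^ i) → Fin k → ℝ × ℝ) (z : Fin (2 ^ (i + 1)) → ℝ) (j : Fin (2 ^ i)) :
    (deriv (hinge (sgn b)) (avgPool (block W V z)) + deriv (reg lam) (avgPool (block W V z))) *
        deriv hardTanh (preact (W j) (V j) (pair z j)) =
      -(sgn b + lam) * deriv hardTanh (preact (W j) (V j) (pair z j)) := by
  rcases deriv_hardTanh_eq_one_or (h := preact (W j) (V j) (pair z j)) with ⟨-, h1, h2⟩ | ⟨e, -⟩
  · have hlt : |avgPool (block W V z)| < 1 := by
      refine abs_avgPool_lt (fun j => abs_hardTanh_le _) (j := j) ?_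
      simp only [block, neuralGate, hardTanh]
      rw [min_eq_left h2.le, max_eq_left h1.le]
      exact abs_lt.mpr ⟨h1, h2⟩
    obtain ⟨h3, h4⟩ := abs_lt.mp hlt
    rw [deriv_hinge, deriv_reg, if_pos h4, if_pos]
    · ring
    · rcases sgn_eq_or b with e | e <;> rw [e] <;> linarith
  · rw [e]; ring

/-- The aggregated weight `(y + λ) / m` of the examples with a given pattern. -/
def labelWeight {m : ℕ} (lam : ℝ) (q : Fin m → Bool × Bool) (y : Fin m → Bool) (p : Bool × Bool) :
    ℝ :=
  (∑ s, if q s = p then sgn (y s) + lam else 0) / m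

/-- After decoupling, the factor of an example depends only on its label and on its pattern at gate
`j`, so the sum over the sample can be grouped by patterns. -/
theorem gdStep_eq_gateStep {m k i : ℕ} (η lam : ℝ) {z : Fin m → Fin (2 ^ (i + 1)) → ℝ}
    (y : Fin m → Bool) (V : Fin (2 ^ i) → Fin k → ℝ) (W : Fin (2 ^ i) → Fin k → ℝ × ℝ)
    {j : Fin (2 ^ i)} {q : Fin m → Bool × Bool} (hq : ∀ s, pair (z s) j = pt (q s)) :
    gdStep η lam z (fun s => sgn (y s)) V W j =
      gateStep (η / 2 ^ i) (labelWeight lam q y) (V j) (W j) := by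
  have key (l : Fin k) (g : Bool × Bool → ℝ) :
      -(η * ((∑ s, (deriv (hinge (sgn (y s))) (avgPool (block W V (z s)))
          + deriv (reg lam) (avgPool (block W V (z s))))
        * ((deriv hardTanh (preact (W j) (V j) (pair (z s) j))
          * (V j l * deriv relu (dot (W j l) (pair (z s) j)))) / (2 ^ i : ℕ)) * g (q s)) / m)) =
      ∑ p, η / 2 ^ i * (labelWeight lam q y p * (deriv hardTanh (preact (W j) (V j) (pt p)) *
        (V j l * deriv relu (dot (W j l) (pt p))))) * g p := by
    have h1 (s : Fin m) : (deriv (hinge (sgn (y s))) (avgPool (block W V (z s)))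
          + deriv (reg lam) (avgPool (block W V (z s))))
        * ((deriv hardTanh (preact (W j) (V j) (pair (z s) j))
          * (V j l * deriv relu (dot (W j l) (pair (z s) j)))) / (2 ^ i : ℕ)) * g (q s) =
        ∑ p, (if q s = p then sgn (y s) + lam else 0) *
          (-(deriv hardTanh (preact (W j) (V j) (pt p)) *
        (V j l * deriv relu (dot (W j l) (pt p)))) / 2 ^ i * g p) := by
      have h2 := deriv_loss_mul lam (y s) V W (z s) j
      simp only [ite_mul, zero_mul, Finset.sum_ite_eq, Finset.mem_univ, if_true]
      rw [hq] at h2 ⊢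
      push_cast
      linear_combination (V j l * deriv relu (dot (W j l) (pt (q s))) / 2 ^ i * g (q s)) * h2
    simp only [h1]
    rw [Finset.sum_comm]
    simp only [← Finset.sum_mul]
    rw [Finset.sum_div, Finset.mul_sum, ← Finset.sum_neg_distrib]
    refine Finset.sum_congr rfl fun p _ => ?_
    rw [labelWeight]
    ring
  funext l
  have k1 := key l fun p => (pt p).1
  have k2 := key l fun p => (pt p).2
  simp only [gdStep, gateStep, sampleGrad]
  rw [← k1, ← k2]
  simp only [hq, sub_eq_add_neg]

theorem iterate_gdStep_eq {m k i : ℕ} (η lam : ℝ) {z : Fin m → Fin (2 ^ (i + 1)) → ℝ}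
    (y : Fin m → Bool) (V : Fin (2 ^ i) → Fin k → ℝ) (W : Fin (2 ^ i) → Fin k → ℝ × ℝ)
    {j : Fin (2 ^ i)} {q : Fin m → Bool × Bool} (hq : ∀ s, pair (z s) j = pt (q s)) (T : ℕ) :
    (gdStep η lam z (fun s => sgn (y s)) V)^[T] W j =
      (gateStep (η / 2 ^ i) (labelWeight lam q y) (V j))^[T] (W j) := by
  induction T with
  | zero => rfl
  | succ T ih =>
    rw [Function.iterate_succ_apply', Function.iterate_succ_apply',
      gdStep_eq_gateStep η lam y V _ hq, ih]

/-! ## Expectations over finite types -/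

/-- The expectation of `f` under a distribution on a finite type. -/
def expect {α : Type} [Fintype α] (p : PMF α) (f : α → ℝ) : ℝ := ∑ a, (p a).toReal * f a

section expect

variable {α β : Type} [Fintype α] [Fintype β]

theorem expect_pure (a : α) (f : α → ℝ) : expect (PMF.pure a) f = f a := by
  classical
  simp [expect, PMF.pure_apply, apply_ite ENNReal.toReal]

theorem expect_bind (p : PMF α) (q : α → PMF β) (f : β → ℝ) :
    expect (p.bind q) f = expect p fun a => expect (q a) f := by
  simp only [expect, PMF.bind_apply, tsum_fintype, Finset.mul_sum]
  rw [Finset.sum_comm]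
  refine Finset.sum_congr rfl fun b _ => ?_
  rw [ENNReal.toReal_sum fun a _ => ENNReal.mul_ne_top (p.apply_ne_top a) ((q a).apply_ne_top b),
    Finset.sum_mul]
  simp only [ENNReal.toReal_mul, mul_assoc]

theorem expect_map (p : PMF α) (g : α → β) (f : β → ℝ) :
    expect (p.map g) f = expect p fun a => f (g a) := by
  rw [← PMF.bind_pure_comp, expect_bind]
  simp only [Function.comp, expect_pure]

theorem expect_add (p : PMF α) (f g : α → ℝ) :
    expect p (fun a => f a + g a) = expect p f + expect p g := by
  simp only [expect, mul_add, Finset.sum_add_distrib]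

theorem expect_const_mul (p : PMF α) (c : ℝ) (f : α → ℝ) :
    expect p (fun a => c * f a) = c * expect p f := by
  simp only [expect, Finset.mul_sum]
  exact Finset.sum_congr rfl fun a _ => by ring

theorem expect_const (p : PMF α) (c : ℝ) : expect p (fun _ => c) = c := by
  have h := p.tsum_coe
  rw [tsum_fintype] at h
  have h' : ∑ a, (p a).toReal = 1 := by
    rw [← ENNReal.toReal_sum fun a _ => p.apply_ne_top a, h, ENNReal.toReal_one]
  rw [expect, ← Finset.sum_mul, h', one_mul]

theorem expect_mono (p : PMF α) {f g : α → ℝ} (h : ∀ a, f a ≤ g a) : expect p f ≤ expect p g :=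
  Finset.sum_le_sum fun a _ => mul_le_mul_of_nonneg_left (h a) ENNReal.toReal_nonneg

theorem integral_toMeasure [MeasurableSpace α] [MeasurableSingletonClass α] (p : PMF α)
    (f : α → ℝ) : ∫ a, f a ∂p.toMeasure = expect p f := by
  rw [PMF.integral_eq_sum]; rfl

theorem expect_uniformOfFinset {s : Finset α} (hs : s.Nonempty) (f : α → ℝ) :
    expect (PMF.uniformOfFinset s hs) f = (∑ a ∈ s, f a) / s.card := by
  classical
  simp only [expect, PMF.uniformOfFinset_apply, apply_ite ENNReal.toReal, ENNReal.toReal_inv,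
    ENNReal.toReal_natCast, ENNReal.toReal_zero, ite_mul, zero_mul]
  rw [← Finset.sum_filter, Finset.sum_div, Finset.filter_mem_eq_inter, Finset.univ_inter]
  exact Finset.sum_congr rfl fun a _ => by rw [mul_comm, div_eq_mul_inv]

end expect

theorem indep_apply {ι α : Type} [Fintype ι] [DecidableEq ι] [Fintype α] [MeasurableSpace α]
    [MeasurableSingletonClass α] (p : ι → PMF α) (x : ι → α) : indep p x = ∏ j, p j (x j) := by
  rw [indep, Measure.toPMF_apply, Measure.pi_singleton]
  exact Finset.prod_congr rfl fun j _ =>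
    (p j).toMeasure_apply_singleton _ (measurableSet_singleton _)

theorem expect_indep {ι α : Type} [Fintype ι] [DecidableEq ι] [Fintype α] [MeasurableSpace α]
    [MeasurableSingletonClass α] (p : ι → PMF α) (j : ι) (f : α → ℝ) :
    expect (indep p) (fun x => f (x j)) = expect (p j) f := by
  rw [← integral_toMeasure, ← integral_toMeasure, indep, Measure.toPMF_toMeasure]
  exact integral_comp_eval (μ := fun j => (p j).toMeasure)
    (Measurable.of_discrete (f := f)).aestronglyMeasurable

/-! ## The generative distribution -/

theorem parent_left {i : ℕ} (j : Fin (2 ^ i)) : parent (left j) = j := by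
  ext; simp [parent, left]

theorem parent_right {i : ℕ} (j : Fin (2 ^ i)) : parent (right j) = j := by
  ext; simp [parent, right]; omega

theorem pair_flatten {α : Type} {i : ℕ} (x' : Fin (2 ^ i) → α × α) (j : Fin (2 ^ i)) :
    pair (flatten x') j = x' j := by
  have h1 : ((left j : Fin (2 ^ (i + 1))) : ℕ) % 2 = 0 := by simp [left]
  have h2 : ¬ ((right j : Fin (2 ^ (i + 1))) : ℕ) % 2 = 0 := by simp [right]
  simp only [pair, flatten, if_pos h1, if_neg h2, parent_left, parent_right]

theorem map_eq_pure {α β : Type} (p : PMF α) (f : α → β) (b : β) (h : ∀ a, p a ≠ 0 → f a = b) :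
    p.map f = PMF.pure b := by
  classical
  ext c
  rw [PMF.map_apply, PMF.pure_apply]
  split_ifs with hc
  · subst hc
    rw [← p.tsum_coe]
    refine tsum_congr fun a => ?_
    split_ifs with e
    · rfl
    · by_contra hne
      exact e (h a (Ne.symm hne)).symm
  · refine ENNReal.tsum_eq_zero.mpr fun a => ?_
    split_ifs with e
    · by_contra hne
      exact hc (e.trans (h a hne))
    · rfl

namespace Circuit

variable {d : ℕ} (C : Circuit d)

/-- Evaluating the gates of level `i` on the `(i+1)`-st distribution gives the `i`-th one. -/
theorem map_layer_gen {i : ℕ} (h : i + 1 ≤ d) :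
    (C.gen (i + 1) h).map (fun xy => (C.layer ⟨i, h⟩ xy.1, xy.2)) =
      C.gen i (Nat.le_of_succ_le h) := by
  rw [gen, PMF.map_bind]
  conv_rhs => rw [← PMF.bind_pure (C.gen i (Nat.le_of_succ_le h))]
  congr 1
  funext zy
  rw [PMF.map_comp]
  refine map_eq_pure _ _ _ fun x' hx' => ?_
  rw [indep_apply, Finset.prod_ne_zero_iff] at hx'
  refine Prod.ext (funext fun j => ?_) rfl
  have hj := hx' j (Finset.mem_univ j)
  rw [← PMF.mem_support_iff, PMF.mem_support_uniformOfFinset_iff, Gate.patterns,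
    Finset.mem_filter] at hj
  simp only [Function.comp, layer, pair_flatten]
  exact hj.2

/-- Conditioning on level `i`, only the marginal law of one gate's inputs matters, and that is
uniform on a fibre of the gate. -/
theorem expect_gen_succ {i : ℕ} (h : i + 1 ≤ d) (j : Fin (2 ^ i)) (f : Bool × Bool → Bool → ℝ) :
    expect (C.gen (i + 1) h) (fun s => f (pair s.1 j) s.2) =
      expect (C.gen i (Nat.le_of_succ_le h)) fun s =>
        (∑ p ∈ (C ⟨i, h⟩ j).patterns (s.1 j), f p s.2) / ((C ⟨i, h⟩ j).patterns (s.1 j)).card := by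
  rw [gen, expect_bind]
  congr 1
  funext zy
  rw [expect_map]
  simp only [pair_flatten]
  rw [expect_indep _ j fun p => f p zy.2, expect_uniformOfFinset]

/-- The label is carried unchanged through all levels. -/
theorem expect_label {i : ℕ} (h : i ≤ d) : expect (C.gen i h) (fun s => sgn s.2) = 0 := by
  induction i with
  | zero =>
    rw [gen, expect_map]
    simp [expect, sgn, PMF.uniformOfFintype_apply]
  | succ i ih =>
    rw [← ih (Nat.le_of_succ_le h), ← C.map_layer_gen h, expect_map]

theorem meanLabel_eq_zero : C.meanLabel = 0 := by
  rw [meanLabel, integral_toMeasure, dist, expect_label]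

end Circuit

/-! ### Correlation of nodes and patterns with the label -/

/-- Whether the gate is `∧` or `∨`, hence positively correlated with its inputs. -/
def Gate.isMonotone : Gate → Bool
  | .and | .or => true
  | .nand | .nor => false

/-- The mean of an input bit of a gate when the output is zero on average. -/
def Gate.bias : Gate → ℝ
  | .and | .nand => 1 / 3
  | .or | .nor => -1 / 3

/-- One fibre of each gate is a single pattern with equal bits and the other has three patterns, so
the two conditional means are `±1` and `∓1/3`. Their half-difference has absolute value `2/3` for
every gate type, with sign given by monotonicity. -/
theorem Gate.mean_fst (g : Gate) (b : Bool) :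
    (∑ p ∈ g.patterns b, sgn p.1) / (g.patterns b).card =
      g.bias + 2 / 3 * (sgn g.isMonotone * sgn b) := by
  cases g <;> cases b <;>
    simp [-Finset.sum_boole, Gate.patterns, Finset.sum_filter,
      Finset.natCast_card_filter, Fintype.sum_prod_type, Gate.eval, sgn, Gate.bias, Gate.isMonotone] <;> norm_num

theorem Gate.mean_snd (g : Gate) (b : Bool) :
    (∑ p ∈ g.patterns b, sgn p.2) / (g.patterns b).card =
      g.bias + 2 / 3 * (sgn g.isMonotone * sgn b) := by
  cases g <;> cases b <;>
    simp [-Finset.sum_boole, Gate.patterns, Finset.sum_filter,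
      Finset.natCast_card_filter, Fintype.sum_prod_type, Gate.eval, sgn, Gate.bias, Gate.isMonotone] <;> norm_num

theorem Gate.card_patterns_le (g : Gate) (b : Bool) : (g.patterns b).card ≤ 3 := by
  cases g <;> cases b <;> decide

theorem sgn_beq (a b : Bool) : sgn (a == b) = sgn a * sgn b := by
  cases a <;> cases b <;> simp [sgn]

namespace Circuit

variable {d : ℕ} (C : Circuit d)

/-- The sign of the correlation between the value of a node and the label. -/
def orient : (i : ℕ) → i ≤ d → Fin (2 ^ i) → Bool
  | 0, _, _ => true
  | i + 1, h, t =>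
    orient i (Nat.le_of_succ_le h) (parent t) == (C ⟨i, h⟩ (parent t)).isMonotone

theorem eq_left_or_right {i : ℕ} (t : Fin (2 ^ (i + 1))) :
    t = left (parent t) ∨ t = right (parent t) := by
  rcases Nat.even_or_odd' (t : ℕ) with ⟨c, hc | hc⟩
  · left; ext; simp [left, parent]; omega
  · right; ext; simp [right, parent]; omega

/-- The conditional mean of an input is affine in the gate value. Its constant term is multiplied by
the mean label, which is zero, so only the slope `±2/3` is passed on. -/
theorem expect_label_mul {i : ℕ} (h : i ≤ d) (j : Fin (2 ^ i)) :
    expect (C.gen i h) (fun s => sgn s.2 * sgn (s.1 j)) = sgn (C.orient i h j) * (2 / 3) ^ i := by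
  induction i with
  | zero =>
    rw [gen, expect_map]
    simp [expect, sgn, PMF.uniformOfFintype_apply, orient]
    norm_num
  | succ i ih =>
    have h' := Nat.le_of_succ_le h
    set g := C ⟨i, h⟩ (parent j) with hg
    have main : expect (C.gen (i + 1) h) (fun s => sgn s.2 * sgn (s.1 j)) =
        expect (C.gen i h') fun s => g.bias * sgn s.2 +
          (2 / 3 * sgn g.isMonotone) * (sgn s.2 * sgn (s.1 (parent j))) := by
      rcases eq_left_or_right j with e | e
      · have := C.expect_gen_succ h (parent j) fun p y => sgn y * sgn p.1
        simp only [pair, ← e, ← Finset.mul_sum, mul_div_assoc, Gate.mean_fst] at this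
        rw [this]
        congr 1; funext s; ring
      · have := C.expect_gen_succ h (parent j) fun p y => sgn y * sgn p.2
        simp only [pair, ← e, ← Finset.mul_sum, mul_div_assoc, Gate.mean_snd] at this
        rw [this]
        congr 1; funext s; ring
    rw [main, expect_add, expect_const_mul, expect_const_mul, expect_label, ih h']
    simp only [orient, sgn_beq, ← hg]
    ring

/-- The expected weight `y + λ` on the event that the inputs of a gate form the pattern `p`. -/
def patternWeight (lam : ℝ) {i : ℕ} (h : i + 1 ≤ d) (j : Fin (2 ^ i)) (p : Bool × Bool) : ℝ :=
  expect (C.gen (i + 1) h) fun s => if pair s.1 j = p then sgn s.2 + lam else 0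

/-- With `b` the gate output on `p`, the node has value `b` with label-weighted mass `±(2/3)^i / 2`,
and at most three patterns share it equally. The regularization adds at most `Δ/4` before this
division, while `(2/3)^i / 2 ≥ 3Δ/4`; hence `(3/4 - 1/4)Δ/3 = Δ/6`. -/
theorem margin_le_patternWeight {i : ℕ} (h : i + 1 ≤ d) (j : Fin (2 ^ i)) (p : Bool × Bool) :
    margin d / 6 ≤ sgn (C.orient i (Nat.le_of_succ_le h) j) * sgn ((C ⟨i, h⟩ j).eval p.1 p.2) *
      C.patternWeight (margin d / 4) h j p := by
  set g := C ⟨i, h⟩ j with hg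
  set b := g.eval p.1 p.2 with hb
  set o := C.orient i (Nat.le_of_succ_le h) j with ho
  set lam := margin d / 4 with hlam
  have hmar : 0 < margin d := by unfold margin; positivity
  have hpw : margin d ≤ 2 / 3 * (2 / 3) ^ i := by
    rw [← pow_succ']
    exact pow_le_pow_of_le_one (by norm_num) (by norm_num) h
  set P := expect (C.gen i (Nat.le_of_succ_le h)) fun s => if s.1 j = b then (1 : ℝ) else 0 with hP
  have hP1 : P ≤ 1 := by
    rw [← expect_const (C.gen i (Nat.le_of_succ_le h)) 1]
    exact expect_mono _ fun s => by split_ifs <;> norm_num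
  have hP0 : 0 ≤ P := by
    rw [← expect_const (C.gen i (Nat.le_of_succ_le h)) 0]
    exact expect_mono _ fun s => by split_ifs <;> norm_num
  have hc0 : (0 : ℝ) < (g.patterns b).card := by
    exact_mod_cast (g.patterns_nonempty b).card_pos
  have hc3 : ((g.patterns b).card : ℝ) ≤ 3 := by exact_mod_cast g.card_patterns_le b
  set c : ℝ := ((g.patterns b).card : ℝ) with hc
  have key : C.patternWeight lam h j p = (sgn o * sgn b * (2 / 3) ^ i / 2 + lam * P) / c := by
    have h1 := C.expect_gen_succ h j fun q y => if q = p then sgn y + lam else 0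
    -- For the label term, the indicator of `s.1 j = b` is written as `(1 + sgn b * sgn (s.1 j)) /
    -- 2`.
    have h2 : ∀ s : (Fin (2 ^ i) → Bool) × Bool,
        (∑ q ∈ g.patterns (s.1 j), if q = p then sgn s.2 + lam else 0) /
          ((g.patterns (s.1 j)).card : ℝ) =
        1 / (2 * c) * sgn s.2 + (sgn b / (2 * c) * (sgn s.2 * sgn (s.1 j)) +
          lam / c * if s.1 j = b then (1 : ℝ) else 0) := by
      intro s
      rw [Finset.sum_ite_eq']
      by_cases e : s.1 j = b
      · rw [if_pos (by rw [Gate.patterns, e]; simp [hb]), if_pos e, e, ← hc]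
        have := sgn_sq b
        clear_value c lam
        field_simp
        linear_combination (-sgn s.2) * this
      · have e' : s.1 j = !b := by
          revert e; cases s.1 j <;> cases b <;> simp
        rw [if_neg (by rw [Gate.patterns]; simpa [← hb] using Ne.symm e), if_neg e, e', sgn_not]
        have := sgn_sq b
        clear_value c lam
        field_simp
        linear_combination (sgn s.2) * this
    rw [patternWeight, h1]
    simp only [← hg, h2]
    rw [expect_add, expect_add, expect_const_mul, expect_const_mul, expect_const_mul, expect_label,
      expect_label_mul, ← ho, ← hP]
    ring
  rw [key]
  have hs : (sgn o * sgn b) * (sgn o * sgn b) = 1 := by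
    rw [mul_mul_mul_comm, sgn_sq, sgn_sq, one_mul]
  have hs' : -1 ≤ sgn o * sgn b := by
    rcases sgn_eq_or o with e | e <;> rcases sgn_eq_or b with e' | e' <;> rw [e, e'] <;> norm_num
  have h1 : sgn o * sgn b * ((sgn o * sgn b * (2 / 3) ^ i / 2 + lam * P) / c) =
      ((2 / 3) ^ i / 2 + sgn o * sgn b * (lam * P)) / c := by
    linear_combination ((2 / 3) ^ i / 2 / c) * hs
  rw [h1, le_div_iff₀ hc0]
  have h2 : 0 ≤ lam * P := by positivity
  have h3 : lam * P ≤ lam := mul_le_of_le_one_right (by positivity) hP1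
  have h4 : -(lam * P) ≤ sgn o * sgn b * (lam * P) := by nlinarith
  nlinarith

end Circuit

/-! ## Concentration of the label weights -/

section Hoeffding

variable {Ω : Type} [Fintype Ω] [MeasurableSpace Ω] [MeasurableSingletonClass Ω]

theorem measureReal_le_sum_sub_le (D : PMF Ω) {f : Ω → ℝ} {a b : ℝ}
    (hf : ∀ x, f x ∈ Set.Icc a b) (hab : b - a = 2) {m : ℕ} (hm : 0 < m) {τ : ℝ} (hτ : 0 ≤ τ) :
    (Measure.pi fun _ : Fin m => D.toMeasure).real
      {S | τ ≤ (∑ s, f (S s)) / m - expect D f} ≤ Real.exp (-(m * τ ^ 2 / 2)) := by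
  set P := Measure.pi fun _ : Fin m => D.toMeasure with hP
  have hint (s : Fin m) : ∫ S, f (S s) ∂P = expect D f := by
    rw [← integral_toMeasure]
    exact integral_comp_eval (μ := fun _ : Fin m => D.toMeasure)
      (Measurable.of_discrete (f := f)).aestronglyMeasurable
  have hsub (s : Fin m) : ProbabilityTheory.HasSubgaussianMGF
      (fun S : Fin m → Ω => f (S s) - expect D f) 1 P := by
    have h := ProbabilityTheory.hasSubgaussianMGF_of_mem_Icc (μ := P)
      (X := fun S : Fin m → Ω => f (S s)) (a := a) (b := b)
      ((Measurable.of_discrete (f := f)).comp (measurable_pi_apply s)).aemeasurable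
      (ae_of_all _ fun S => hf (S s))
    -- Hoeffding's lemma: an interval of length 2 gives sub-Gaussian parameter 1.
    have e : (‖b - a‖₊ / 2) ^ 2 = 1 := by
      rw [hab, Real.nnnorm_two, div_self two_ne_zero, one_pow]
    rw [hint, e] at h
    exact h
  have hind : ProbabilityTheory.iIndepFun (fun s (S : Fin m → Ω) => f (S s) - expect D f) P :=
    ProbabilityTheory.iIndepFun_pi (μ := fun _ : Fin m => D.toMeasure)
      (X := fun _ x => f x - expect D f) fun _ => Measurable.of_discrete.aemeasurable
  have hm' : (0 : ℝ) < m := by exact_mod_cast hm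
  have h := ProbabilityTheory.HasSubgaussianMGF.measure_sum_ge_le_of_iIndepFun hind
    (s := Finset.univ) (fun s _ => hsub s) (ε := m * τ) (by positivity)
  refine le_trans (le_of_eq ?_) (h.trans (le_of_eq ?_))
  · congr 1
    ext S
    simp only [Set.mem_ofPred_eq, Finset.sum_sub_distrib, Finset.sum_const, Finset.card_univ,
      Fintype.card_fin, nsmul_eq_mul]
    rw [← mul_le_mul_iff_right₀ hm', mul_sub, mul_div_cancel₀ _ hm'.ne']
  · congr 1
    simp only [Finset.sum_const, Finset.card_univ, Fintype.card_fin, nsmul_eq_mul, mul_one]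
    push_cast
    field_simp

/-- Hoeffding's inequality for the empirical mean of an i.i.d. sample. -/
theorem measure_abs_empirical_sub_le (D : PMF Ω) {f : Ω → ℝ} {a b : ℝ}
    (hf : ∀ x, f x ∈ Set.Icc a b) (hab : b - a = 2) {m : ℕ} (hm : 0 < m) {τ : ℝ} (hτ : 0 ≤ τ) :
    (Measure.pi fun _ : Fin m => D.toMeasure) {S | ¬ |(∑ s, f (S s)) / m - expect D f| ≤ τ} ≤
      ENNReal.ofReal (2 * Real.exp (-(m * τ ^ 2 / 2))) := by
  have h1 := measureReal_le_sum_sub_le D hf hab hm hτ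
  have h2 := measureReal_le_sum_sub_le D (f := fun x => -f x) (a := -b) (b := -a)
    (fun x => ⟨neg_le_neg (hf x).2, neg_le_neg (hf x).1⟩) (by linarith) hm hτ
  rw [← ofReal_measureReal]
  refine ENNReal.ofReal_le_ofReal ?_
  rw [two_mul]
  refine le_trans ?_ (add_le_add h1 h2)
  refine le_trans (measureReal_mono ?_) (measureReal_union_le _ _)
  intro S hS
  simp only [Set.mem_ofPred_eq, not_le] at hS
  have e : expect D (fun x => -f x) = -expect D f := by
    simpa using expect_const_mul D (-1) f
  rcases lt_abs.mp hS with h | h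
  · exact Or.inl h.le
  · right
    simp only [Set.mem_ofPred_eq, Finset.sum_neg_distrib, e, neg_div]
    linarith

end Hoeffding

theorem measure_iUnion_le_card_mul {ι Ω : Type} [Fintype ι] [MeasurableSpace Ω] (P : Measure Ω)
    {E : ι → Set Ω} {β : ENNReal} (h : ∀ i, P (E i) ≤ β) :
    P (⋃ i, E i) ≤ (Fintype.card ι : ENNReal) * β := by
  refine (measure_iUnion_fintype_le P E).trans ((Finset.sum_le_sum fun i _ => h i).trans ?_)
  simp

namespace Circuit

variable {d : ℕ} (C : Circuit d)

/-- The label weights of all gates on level `< i` are within `τ` of their expectations, when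
`val x` are the values at the nodes of level `i` for the input `x`. -/
def GoodSample {m : ℕ} (lam τ : ℝ) (S : Sample d m) :
    (i : ℕ) → i ≤ d → ((Fin (2 ^ d) → Bool) → Fin (2 ^ i) → Bool) → Prop
  | 0, _, _ => True
  | i + 1, h, val =>
    (∀ j p, |labelWeight lam (fun s => pair (val (S s).1) j) (fun s => (S s).2) p -
      C.patternWeight lam h j p| ≤ τ) ∧
    GoodSample lam τ S i (Nat.le_of_succ_le h) fun x => C.layer ⟨i, h⟩ (val x)

/-- There are four tests per gate, and the number of gates on levels below `i` is less than `2 ^ i`.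
The hypothesis `hval` passes to the next level by `map_layer_gen`, so each test compares an
empirical mean with its true expectation. -/
theorem measure_not_goodSample_le {m : ℕ} (hm : 0 < m) {lam τ : ℝ} (hlam : 0 ≤ lam)
    (hlam1 : lam ≤ 1) (hτ : 0 ≤ τ) {i : ℕ} (h : i ≤ d)
    {val : (Fin (2 ^ d) → Bool) → Fin (2 ^ i) → Bool}
    (hval : C.dist.map (fun s => (val s.1, s.2)) = C.gen i h) :
    (Measure.pi fun _ : Fin m => C.dist.toMeasure) {S | ¬ C.GoodSample lam τ S i h val} ≤
      ((4 * 2 ^ i : ℕ) : ENNReal) * ENNReal.ofReal (2 * Real.exp (-(m * τ ^ 2 / 2))) := by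
  induction i with
  | zero => simp [GoodSample]
  | succ i ih =>
    set β := ENNReal.ofReal (2 * Real.exp (-(m * τ ^ 2 / 2))) with hβ
    have ih' := ih (Nat.le_of_succ_le h) (val := fun x => C.layer ⟨i, h⟩ (val x)) (by
      rw [← C.map_layer_gen h, ← hval, PMF.map_comp]; rfl)
    have hjp (jp : Fin (2 ^ i) × (Bool × Bool)) :
        (Measure.pi fun _ : Fin m => C.dist.toMeasure) {S | ¬ |labelWeight lam
          (fun s => pair (val (S s).1) jp.1) (fun s => (S s).2) jp.2 -
            C.patternWeight lam h jp.1 jp.2| ≤ τ} ≤ β := by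
      have := measure_abs_empirical_sub_le C.dist
        (f := fun s => if pair (val s.1) jp.1 = jp.2 then sgn s.2 + lam else 0)
        -- The interval also has to contain 0, the value off the pattern; this is where `0 ≤ lam ≤
        -- 1` enters.
        (a := -1 + lam) (b := 1 + lam) (fun x => by
          rcases sgn_eq_or x.2 with e | e <;> split_ifs <;> rw [Set.mem_Icc] <;>
            constructor <;> linarith) (by ring) hm hτ
      rw [patternWeight, ← hval, expect_map]
      exact this
    have hsub : {S : Sample d m | ¬ C.GoodSample lam τ S (i + 1) h val} ⊆
        (⋃ jp : Fin (2 ^ i) × (Bool × Bool), {S | ¬ |labelWeight lam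
          (fun s => pair (val (S s).1) jp.1) (fun s => (S s).2) jp.2 -
            C.patternWeight lam h jp.1 jp.2| ≤ τ}) ∪
        {S | ¬ C.GoodSample lam τ S i (Nat.le_of_succ_le h)
          fun x => C.layer ⟨i, h⟩ (val x)} := by
      intro S hS
      simp only [Set.mem_ofPred_eq, GoodSample, not_and_or, not_forall] at hS
      rcases hS with ⟨j, p, hS⟩ | hS
      · exact Or.inl (Set.mem_iUnion.mpr ⟨(j, p), hS⟩)
      · exact Or.inr hS
    refine (measure_mono hsub).trans ((measure_union_le _ _).trans ?_)
    have h1 := measure_iUnion_le_card_mul (Measure.pi fun _ : Fin m => C.dist.toMeasure) hjp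
    refine (add_le_add h1 ih').trans (le_of_eq ?_)
    simp only [Fintype.card_prod, Fintype.card_fin, Fintype.card_bool]
    rw [← add_mul, ← Nat.cast_add]
    congr 2
    ring

end Circuit

/-! ## The initialization -/

section Initialization

variable {μ : Measure (ℝ × ℝ)} {B : ℝ}

theorem measurable_dot (x : ℝ × ℝ) : Measurable fun w => dot w x := by
  unfold dot; fun_prop

/-- The initial values `(w, v)` for which the neuron has second-layer weight `b` and is active on the
pattern `p`. -/
def goodNeuron (b : Bool) (p : Bool × Bool) : Set ((ℝ × ℝ) × Bool) :=
  {w | 0 < dot w (pt p)} ×ˢ {b}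

theorem measurableSet_goodNeuron (b : Bool) (p : Bool × Bool) :
    MeasurableSet (goodNeuron b p) :=
  (measurableSet_lt measurable_const (measurable_dot _)).prod (measurableSet_singleton b)

theorem measureReal_goodNeuron (hμ : IsInitLaw B μ) (b : Bool) (p : Bool × Bool) :
    (μ.prod (PMF.uniformOfFintype Bool).toMeasure).real (goodNeuron b p) = 1 / 4 := by
  have := hμ.prob
  have h : μ {w | 0 < dot w (pt p)} = 1 / 2 := hμ.half p
  rw [Measure.real, goodNeuron, Measure.prod_prod, h,
    PMF.toMeasure_apply_singleton _ _ (measurableSet_singleton b), PMF.uniformOfFintype_apply]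
  simp
  norm_num

theorem disjoint_goodNeuron (b b' : Bool) (p : Bool × Bool) :
    Disjoint (goodNeuron b p) (goodNeuron b' (anti p)) := by
  rw [Set.disjoint_left]
  rintro ⟨w, v⟩ ⟨h1, -⟩ ⟨h2, -⟩
  simp only [Set.mem_ofPred_eq, dot_anti] at h1 h2
  linarith

/-- All neurons of a gate avoid a set. -/
theorem measureReal_pi_forall {G : Type} [Fintype G] {k : ℕ} {E : Type}
    [MeasurableSpace E] (ν : Measure E) [IsProbabilityMeasure ν] (g : G) (A : Set E) :
    (Measure.pi fun _ : G × Fin k => ν).real {θ | ∀ l, θ (g, l) ∈ A} = ν.real A ^ k := by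
  classical
  have e : {θ : G × Fin k → E | ∀ l, θ (g, l) ∈ A} =
      Set.pi Set.univ fun n => if n.1 = g then A else Set.univ := by
    ext θ
    simp only [Set.mem_ofPred_eq, Set.mem_pi, Set.mem_univ, true_implies, Prod.forall]
    refine ⟨fun h g' l => ?_, fun h l => ?_⟩
    · split_ifs with hg
      · exact hg ▸ h l
      · trivial
    · simpa using h g l
  rw [e, Measure.real, Measure.pi_pi, Fintype.prod_prod_type, Finset.prod_eq_single g]
  · simp [Measure.real]
  · intro g' _ hg
    simp [hg]
  · simp

/-- Inclusion–exclusion over the two ends of an axis. No neuron is active at both ends, so the two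
good events of one neuron are disjoint, of probability `1/4` each. The subtracted term is needed in
`failure_le`. -/
theorem measureReal_bad_axis {G : Type} [Fintype G] {k : ℕ} (hμ : IsInitLaw B μ) (g : G)
    (b b' : Bool) (p : Bool × Bool) :
    (Measure.pi fun _ : G × Fin k => μ.prod (PMF.uniformOfFintype Bool).toMeasure).real
      {θ | ¬ ((∃ l, θ (g, l) ∈ goodNeuron b p) ∧ ∃ l, θ (g, l) ∈ goodNeuron b' (anti p))} =
      2 * (3 / 4) ^ k - (1 / 2) ^ k := by
  have := hμ.prob
  set ν := μ.prod (PMF.uniformOfFintype Bool).toMeasure with hν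
  set P := Measure.pi fun _ : G × Fin k => ν with hP
  set E₁ : Set (G × Fin k → (ℝ × ℝ) × Bool) := {θ | ∀ l, θ (g, l) ∈ (goodNeuron b p)ᶜ} with hE₁
  set E₂ : Set (G × Fin k → (ℝ × ℝ) × Bool) :=
    {θ | ∀ l, θ (g, l) ∈ (goodNeuron b' (anti p))ᶜ} with hE₂
  have hm₂ : MeasurableSet E₂ := by
    rw [hE₂, Set.ofPred_forall]
    exact MeasurableSet.iInter fun l =>
      (measurable_pi_apply (g, l)) (measurableSet_goodNeuron _ _).compl
  have hbad : {θ : G × Fin k → (ℝ × ℝ) × Bool | ¬ ((∃ l, θ (g, l) ∈ goodNeuron b p) ∧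
      ∃ l, θ (g, l) ∈ goodNeuron b' (anti p))} = E₁ ∪ E₂ := by
    ext θ
    simp only [Set.mem_ofPred_eq, not_and_or, not_exists, hE₁, hE₂, Set.mem_union,
      Set.mem_compl_iff]
  have hinter : E₁ ∩ E₂ = {θ | ∀ l, θ (g, l) ∈ (goodNeuron b p ∪ goodNeuron b' (anti p))ᶜ} := by
    ext θ
    simp only [hE₁, hE₂, Set.mem_inter_iff, Set.mem_ofPred_eq, Set.compl_union, forall_and]
  have h := measureReal_union_add_inter (μ := P) (s := E₁) hm₂
  have e₁ : P.real E₁ = (3 / 4) ^ k := by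
    rw [hE₁, hP, measureReal_pi_forall, probReal_compl_eq_one_sub (measurableSet_goodNeuron _ _),
      measureReal_goodNeuron hμ]
    norm_num
  have e₂ : P.real E₂ = (3 / 4) ^ k := by
    rw [hE₂, hP, measureReal_pi_forall, probReal_compl_eq_one_sub (measurableSet_goodNeuron _ _),
      measureReal_goodNeuron hμ]
    norm_num
  have e₃ : P.real (E₁ ∩ E₂) = (1 / 2) ^ k := by
    rw [hinter, hP, measureReal_pi_forall, probReal_compl_eq_one_sub
      ((measurableSet_goodNeuron _ _).union (measurableSet_goodNeuron _ _)),
      measureReal_union (disjoint_goodNeuron _ _ _) (measurableSet_goodNeuron _ _),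
      measureReal_goodNeuron hμ, measureReal_goodNeuron hμ]
    norm_num
  rw [hbad]
  linarith

/-- Every gate has, for every pattern, a neuron active on it whose second-layer weight is
as prescribed by `s`. -/
def GoodInit {G : Type} {k : ℕ} (s : G → Bool × Bool → Bool) (θ : G × Fin k → (ℝ × ℝ) × Bool) :
    Prop :=
  ∀ g p, ∃ l, θ (g, l) ∈ goodNeuron (s g p) p

theorem measure_not_goodInit_le {G : Type} [Fintype G] {k : ℕ} (hμ : IsInitLaw B μ)
    (s : G → Bool × Bool → Bool) :
    (Measure.pi fun _ : G × Fin k => μ.prod (PMF.uniformOfFintype Bool).toMeasure)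
      {θ | ¬ GoodInit s θ} ≤
      ENNReal.ofReal (2 * Fintype.card G * (2 * (3 / 4) ^ k - (1 / 2) ^ k)) := by
  have := hμ.prob
  set P := Measure.pi fun _ : G × Fin k => μ.prod (PMF.uniformOfFintype Bool).toMeasure with hP
  rw [← ofReal_measureReal]
  refine ENNReal.ofReal_le_ofReal ?_
  -- The patterns with first bit `true` represent the two axes of a gate.
  have hsub : {θ : G × Fin k → (ℝ × ℝ) × Bool | ¬ GoodInit s θ} ⊆ ⋃ ga : G × Bool,
      {θ | ¬ ((∃ l, θ (ga.1, l) ∈ goodNeuron (s ga.1 (true, ga.2)) (true, ga.2)) ∧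
        ∃ l, θ (ga.1, l) ∈ goodNeuron (s ga.1 (anti (true, ga.2))) (anti (true, ga.2)))} := by
    intro θ hθ
    by_contra hcon
    simp only [Set.mem_iUnion, Set.mem_ofPred_eq, not_exists, not_not] at hcon
    refine hθ fun g p => ?_
    rcases p with ⟨a, b⟩
    cases a
    · have := (hcon (g, !b)).2
      simpa [anti] using this
    · exact (hcon (g, b)).1
  refine (measureReal_mono hsub).trans ((measureReal_iUnion_fintype_le _).trans ?_)
  rw [hP]
  simp only [measureReal_bad_axis hμ]
  simp only [Finset.sum_const, Finset.card_univ, Fintype.card_prod, Fintype.card_bool,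
    nsmul_eq_mul]
  push_cast
  exact le_of_eq (by ring)

theorem measure_not_bounded_eq_zero {ι : Type} [Fintype ι] (hμ : IsInitLaw B μ) :
    (Measure.pi fun _ : ι => μ.prod (PMF.uniformOfFintype Bool).toMeasure)
      {θ | ¬ ∀ n, |(θ n).1.1| ≤ B ∧ |(θ n).1.2| ≤ B} = 0 := by
  have := hμ.prob
  rw [← ae_iff, ae_all_iff]
  intro n
  have h : ∀ᵐ x ∂(μ.prod (PMF.uniformOfFintype Bool).toMeasure), |x.1.1| ≤ B ∧ |x.1.2| ≤ B :=
    Measure.quasiMeasurePreserving_fst.ae hμ.bound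
  exact (Measure.quasiMeasurePreserving_eval
    (fun _ : ι => μ.prod (PMF.uniformOfFintype Bool).toMeasure) n).ae h

end Initialization

/-! ## Correctness of the training of a level -/

theorem abs_labelWeight_le {m : ℕ} {lam : ℝ} (hlam : |lam| ≤ 1) (q : Fin m → Bool × Bool)
    (y : Fin m → Bool) (p : Bool × Bool) : |labelWeight lam q y p| ≤ 2 := by
  rw [labelWeight, abs_div, Nat.abs_cast]
  refine div_le_of_le_mul₀ (Nat.cast_nonneg m) zero_le_two ?_
  calc _ ≤ ∑ s, |if q s = p then sgn (y s) + lam else 0| := Finset.abs_sum_le_sum_abs _ _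
    _ ≤ ∑ _s : Fin m, 2 := by
        refine Finset.sum_le_sum fun s _ => ?_
        split_ifs
        · refine (abs_add_le _ _).trans ?_
          rw [abs_sgn]; linarith
        · simp
    _ = 2 * m := by simp [mul_comm]

/-! ### Nodes computed up to a negation -/

/-- Flip the two bits of a pattern if `o` is false. -/
def flip (o : Bool) (q : Bool × Bool) : Bool × Bool := (o == q.1, o == q.2)

theorem flip_flip (o : Bool) (q : Bool × Bool) : flip o (flip o q) = q := by
  rcases q with ⟨a, b⟩
  cases o <;> simp [flip]

theorem labelWeight_flip {m : ℕ} (lam : ℝ) (o : Bool) (q : Fin m → Bool × Bool)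
    (y : Fin m → Bool) (p : Bool × Bool) :
    labelWeight lam (fun s => flip o (q s)) y p = labelWeight lam q y (flip o p) := by
  have (s : Fin m) : flip o (q s) = p ↔ q s = flip o p :=
    ⟨fun h => by rw [← h, flip_flip], fun h => by rw [h, flip_flip]⟩
  simp only [labelWeight, this]

namespace Circuit

variable {d : ℕ} (C : Circuit d)

/-- Whether the trained network computes the value of a node (and not its negation). -/
def netOrient (i : ℕ) (h : i ≤ d) (t : Fin (2 ^ i)) : Bool :=
  if i = d then true else C.orient i h t

theorem netOrient_of_lt {i : ℕ} (h : i + 1 ≤ d) (t : Fin (2 ^ i)) :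
    C.netOrient i (Nat.le_of_succ_le h) t = C.orient i (Nat.le_of_succ_le h) t :=
  if_neg (Nat.ne_of_lt h)

/-- The orientation of the inputs of a gate of the trained network. -/
def inOrient {i : ℕ} (h : i + 1 ≤ d) (j : Fin (2 ^ i)) : Bool :=
  C.netOrient (i + 1) h (left j)

/-- The output of a trained gate on a pattern. -/
def target {i : ℕ} (h : i + 1 ≤ d) (j : Fin (2 ^ i)) (q : Bool × Bool) : Bool :=
  C.orient i (Nat.le_of_succ_le h) j ==
    (C ⟨i, h⟩ j).eval (flip (C.inOrient h j) q).1 (flip (C.inOrient h j) q).2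

/-- Siblings have the same orientation, as it depends only on their parent (and is `true` at the
leaves). Hence a gate sees its true input pattern or the antipodal one. -/
theorem pair_orient {i : ℕ} (h : i + 1 ≤ d) (j : Fin (2 ^ i)) (u : Fin (2 ^ (i + 1)) → Bool) :
    pair (fun t => sgn (C.netOrient (i + 1) h t == u t)) j =
      pt (flip (C.inOrient h j) (pair u j)) := by
  simp only [pair, netOrient, orient, parent_left, parent_right, pt, flip, inOrient]

end Circuit

/-- The sampling error leaves the label weights a margin `Δ/6 - εΔ/16 ≥ εΔ/2` of the target sign, so
the dynamics of a single gate applies with `f = εΔ/2`. All four patterns are learned, so the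
conclusion holds on every input, not just on the sample. -/
theorem layer_trained {d k m T : ℕ} {δ η : ℝ} (hadm : Admissible d δ k m T η) (hk : 0 < k)
    (hd : 1 ≤ d) (C : Circuit d) {i : ℕ} (h : i + 1 ≤ d) (S : Sample d m)
    {val : (Fin (2 ^ d) → Bool) → Fin (2 ^ (i + 1)) → Bool}
    {N : (Fin (2 ^ d) → ℝ) → Fin (2 ^ (i + 1)) → ℝ}
    (hN : ∀ x, N (fun t => sgn (x t)) = fun t => sgn (C.netOrient (i + 1) h t == val x t))
    (hS : ∀ j p, |labelWeight (margin d / 4) (fun s => pair (val (S s).1) j)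
      (fun s => (S s).2) p - C.patternWeight (margin d / 4) h j p| ≤ patProb d * margin d / 16)
    {w : Fin (2 ^ i) → Fin k → ℝ × ℝ} {v : Fin (2 ^ i) → Fin k → Bool}
    (hw : ∀ j l, |(w j l).1| ≤ 1 / (4 * √2 * k) ∧ |(w j l).2| ≤ 1 / (4 * √2 * k))
    (hgood : ∀ j p, ∃ l, v j l = C.target h j p ∧ 0 < dot (w j l) (pt p))
    (x : Fin (2 ^ d) → Bool) :
    block ((gdStep η (margin d / 4) (fun s => N (S.x s)) S.y fun j l => sgn (v j l))^[T] w)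
      (fun j l => sgn (v j l)) (N fun t => sgn (x t)) =
      fun j => sgn (C.netOrient i (Nat.le_of_succ_le h) j == C.layer ⟨i, h⟩ (val x) j) := by
  have hk' : (0 : ℝ) < k := by exact_mod_cast hk
  have hη := hadm.rate_pos
  have hmar : 0 < margin d := by unfold margin; positivity
  have hmar1 : margin d ≤ 1 := pow_le_one₀ (by norm_num) (by norm_num)
  have hpp : 0 < patProb d := by unfold patProb; positivity
  have hpp4 : patProb d ≤ 1 / 4 := by
    simpa only [patProb, pow_one] using
      pow_le_pow_of_le_one (by norm_num : (0 : ℝ) ≤ 1 / 4) (by norm_num) hd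
  have h2 : (1 : ℝ) ≤ √2 := by rw [Real.one_le_sqrt]; norm_num
  have h2i : (1 : ℝ) ≤ 2 ^ i := one_le_pow₀ (by norm_num)
  have hc : 0 < η / 2 ^ i := by positivity
  have hcη : η / 2 ^ i ≤ η := div_le_self hη.le h2i
  have hηk : η ≤ 1 / (16 * k) := by
    refine hadm.rate.trans (one_div_le_one_div_of_le (by positivity) ?_)
    nlinarith
  have hB : 1 / (4 * √2 * k) ≤ 1 / (4 * k) := by
    refine one_div_le_one_div_of_le (by positivity) ?_
    nlinarith
  -- Since `√2 ≤ 3/2`, the bound `6 * 2 ^ d` on iterations leaves `4 * 2 ^ d ≥ 4 * 2 ^ i`; pooling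
  -- costs the factor `2 ^ i` in the rate.
  have hT : 2 < η / 2 ^ i * (patProb d * margin d / 2) * T := by
    have h3 := hadm.iter
    rw [div_lt_iff₀ (by positivity)] at h3
    have h4 : √2 ≤ 3 / 2 := Real.sqrt_le_iff.mpr ⟨by norm_num, by norm_num⟩
    have h5 : (2 : ℝ) ^ i ≤ 2 ^ d := pow_le_pow_right₀ (by norm_num) (by omega)
    have h6 : 0 ≤ (T : ℝ) * (η * patProb d * margin d) := by positivity
    have h7 : (T : ℝ) * (√2 * η * patProb d * margin d) ≤
        3 / 2 * (T * (η * patProb d * margin d)) := by nlinarith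
    have h8 : 4 * 2 ^ i < (T : ℝ) * (η * patProb d * margin d) := by linarith
    have h9 : η / 2 ^ i * (patProb d * margin d / 2) * T =
        T * (η * patProb d * margin d) / (2 * 2 ^ i) := by
      field_simp
    rw [h9, lt_div_iff₀ (by positivity)]
    linarith
  funext j
  set q : Fin m → Bool × Bool := fun s => flip (C.inOrient h j) (pair (val (S s).1) j) with hq
  have hqs (s : Fin m) : pair (N (S.x s)) j = pt (q s) := by
    have : S.x s = fun t => sgn ((S s).1 t) := rfl
    rw [this, hN, C.pair_orient]
  have hblock := iterate_gdStep_eq η (margin d / 4) (fun s => (S s).2) (fun j l => sgn (v j l)) w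
    hqs T
  have hy : S.y = fun s => sgn (S s).2 := rfl
  rw [hN, block, C.pair_orient, hy, hblock]
  have habs : ∀ p, |labelWeight (margin d / 4) q (fun s => (S s).2) p| ≤ 2 :=
    abs_labelWeight_le (by rw [abs_of_pos (by positivity)]; linarith) _ _
  rw [neuralGate_iterate_gateStep (s := C.target h j) (f := patProb d * margin d / 2)
    -- The scale `M` makes `k * M = 1 / 2`; it dominates the step size, at most `1 / (4 * k)`, and
    -- the initial projections, at most twice `1 / (4 * k)`.
    (M := 1 / (2 * k)) (fun l => sgn_sq _) hc (by positivity) ?_ ?_ ?_ ?_ ?_ hT]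
  · simp only [Circuit.target, flip_flip, C.netOrient_of_lt h]
    rfl
  · intro p
    rw [hq, labelWeight_flip]
    have h3 := hS j (flip (C.inOrient h j) p)
    have h4 := C.margin_le_patternWeight h j (flip (C.inOrient h j) p)
    rw [← sgn_beq] at h4
    change _ ≤ sgn (C.target h j p) * _ at h4
    obtain ⟨h5, h6⟩ := abs_le.mp h3
    have h7 : patProb d * margin d ≤ 1 / 4 * margin d := by gcongr
    rcases sgn_eq_or (C.target h j p) with e | e <;> rw [e] at h4 ⊢ <;> linarith
  · intro p
    have h3 : 2 * (η / 2 ^ i) * |labelWeight (margin d / 4) q (fun s => (S s).2) p| ≤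
        2 * (1 / (16 * k)) * 2 :=
      mul_le_mul (mul_le_mul_of_nonneg_left (hcη.trans hηk) zero_le_two) (habs p)
        (abs_nonneg _) (by positivity)
    refine h3.trans ?_
    field_simp
    norm_num
  · field_simp; rfl
  · intro l p
    have h3 := hw j l
    have h4 : |dot (w j l) (pt p)| ≤ |(w j l).1| + |(w j l).2| := by
      refine (abs_add_le _ _).trans (le_of_eq ?_)
      simp only [pt, abs_mul, abs_sgn, mul_one]
    have h5 : 1 / (4 * (k : ℝ)) + 1 / (4 * k) = 1 / (2 * k) := by field_simp; norm_num
    linarith [h3.1, h3.2]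
  · intro p
    obtain ⟨l, e, hl⟩ := hgood j p
    exact ⟨l, by rw [e], hl⟩

/-! ## Correctness of the algorithm -/

/-- The invariant is that the network so far gives exactly the oriented circuit values on all
Boolean inputs; the targets in `hinit` are fixed before training. -/
theorem trainFrom_eq {d k m T : ℕ} {δ η : ℝ} (hadm : Admissible d δ k m T η) (hk : 0 < k)
    (hd : 1 ≤ d) (C : Circuit d) (S : Sample d m) (θ : Init d k)
    (hinit : GoodInit (fun g : Σ i : Fin d, Fin (2 ^ (i : ℕ)) => C.target g.1.isLt g.2) θ)
    (hθ : ∀ n, |(θ n).1.1| ≤ 1 / (4 * √2 * k) ∧ |(θ n).1.2| ≤ 1 / (4 * √2 * k))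
    {i : ℕ} (h : i ≤ d) {val : (Fin (2 ^ d) → Bool) → Fin (2 ^ i) → Bool}
    {N : (Fin (2 ^ d) → ℝ) → Fin (2 ^ i) → ℝ}
    (hN : ∀ x, N (fun t => sgn (x t)) = fun t => sgn (C.netOrient i h t == val x t))
    (hS : C.GoodSample (margin d / 4) (patProb d * margin d / 16) S i h val)
    (hval : ∀ x, C.evalFrom i h (val x) = C.eval x) (x : Fin (2 ^ d) → Bool) :
    trainFrom T η (margin d / 4) S θ i h N (fun t => sgn (x t)) = sgn (C.eval x) := by
  induction i with
  | zero =>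
    -- As `d ≥ 1`, the root is a trained gate, and its orientation is positive.
    have h0 : C.netOrient 0 h 0 = true := C.netOrient_of_lt hd 0
    have := congrFun (hN x) 0
    rw [h0, Bool.true_beq] at this
    rw [trainFrom, ← hval]
    exact this
  | succ i ih =>
    rw [trainFrom]
    refine ih (Nat.le_of_succ_le h) (val := fun x => C.layer ⟨i, h⟩ (val x)) (fun x => ?_) hS.2
      hval
    refine layer_trained hadm hk hd C h S hN hS.1 (w := θ.W ⟨i, h⟩)
      (v := fun j l => (θ (⟨⟨i, h⟩, j⟩, l)).2) (fun j l => hθ _) (fun j p => ?_) x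
    obtain ⟨l, hl⟩ := hinit ⟨⟨i, h⟩, j⟩ p
    exact ⟨l, hl.2, hl.1⟩

namespace Circuit

variable {d : ℕ} (C : Circuit d)

/-- By `map_layer_gen`, evaluating a layer sends the support of one level's law into that of the
level above, down to the root, where value and label coincide. -/
theorem evalFrom_eq_label {i : ℕ} (h : i ≤ d) {s : (Fin (2 ^ i) → Bool) × Bool}
    (hs : s ∈ (C.gen i h).support) : C.evalFrom i h s.1 = s.2 := by
  induction i with
  | zero =>
    rw [gen, PMF.mem_support_map_iff] at hs
    obtain ⟨y, -, rfl⟩ := hs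
    rfl
  | succ i ih =>
    refine ih (Nat.le_of_succ_le h) (s := (C.layer ⟨i, h⟩ s.1, s.2)) ?_
    rw [← C.map_layer_gen h, PMF.mem_support_map_iff]
    exact ⟨s, hs, rfl⟩

theorem measure_label_ne_eval : C.dist.toMeasure {s | s.2 ≠ C.eval s.1} = 0 := by
  rw [PMF.toMeasure_apply_eq_zero_iff _ (Set.toFinite _).measurableSet, Set.disjoint_left]
  intro s hs hne
  exact hne (C.evalFrom_eq_label le_rfl hs).symm

end Circuit

/-! ### The failure probability -/

theorem card_gates (d : ℕ) : Fintype.card (Σ i : Fin d, Fin (2 ^ (i : ℕ))) = 2 ^ d - 1 := by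
  rw [Fintype.card_sigma]
  simp only [Fintype.card_fin]
  rw [Fin.sum_univ_eq_sum_range (fun i => 2 ^ i), Nat.geomSum_eq le_rfl]
  simp

namespace Admissible

variable {d k m T : ℕ} {δ η : ℝ}

theorem eight_lt (hd : 1 ≤ d) (hδ : 0 < δ) (hδ' : δ < 1 / 2) : 8 < 2 * 2 ^ d * d / δ := by
  have h1 : (2 : ℝ) ≤ 2 ^ d := by
    simpa only [pow_one] using pow_le_pow_right₀ (one_le_two : (1 : ℝ) ≤ 2) hd
  have h2 : (1 : ℝ) ≤ d := by exact_mod_cast hd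
  rw [lt_div_iff₀ hδ]
  nlinarith

theorem width_pos (h : Admissible d δ k m T η) (hd : 1 ≤ d) (hδ : 0 < δ) (hδ' : δ < 1 / 2) :
    0 < k := by
  have h1 := eight_lt hd hδ hδ'
  have h2 : 0 < Real.log (2 * 2 ^ d * d / δ) := Real.log_pos (by linarith)
  have h3 : 0 < Real.log (4 / 3) := Real.log_pos (by norm_num)
  have h4 : 0 < (Real.log (4 / 3))⁻¹ * Real.log (2 * 2 ^ d * d / δ) := by positivity
  exact_mod_cast h4.trans_le h.width

theorem pow_width_le (h : Admissible d δ k m T η) (hd : 1 ≤ d) (hδ : 0 < δ) (hδ' : δ < 1 / 2) :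
    (3 / 4 : ℝ) ^ k ≤ δ / (2 * 2 ^ d * d) := by
  have h1 := eight_lt hd hδ hδ'
  have h3 : 0 < Real.log (4 / 3) := Real.log_pos (by norm_num)
  have h4 := h.width
  rw [inv_mul_le_iff₀ h3] at h4
  have h5 : (2 * 2 ^ d * d / δ : ℝ) ≤ (4 / 3) ^ k := by
    rw [← Real.log_le_log_iff (by linarith) (by positivity), Real.log_pow]
    linarith
  have h6 := inv_anti₀ (by linarith) h5
  rw [← inv_pow] at h6
  rw [inv_div] at h6
  simpa using h6

theorem log_pos (hd : 1 ≤ d) (hδ : 0 < δ) (hδ' : δ < 1 / 2) :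
    0 < Real.log (8 * 2 ^ d * d / δ) := by
  have h1 := eight_lt hd hδ hδ'
  have : 8 * 2 ^ d * d / δ = 4 * (2 * 2 ^ d * d / δ) := by ring
  exact Real.log_pos (by linarith)

theorem sample_pos (h : Admissible d δ k m T η) (hd : 1 ≤ d) (hδ : 0 < δ) (hδ' : δ < 1 / 2) :
    0 < m := by
  have h1 := log_pos hd hδ hδ'
  have h2 : 0 ≤ 2 ^ 11 / (patProb d ^ 2 * margin d ^ 2) * Real.log (8 * 2 ^ d * d / δ) := by
    positivity
  exact_mod_cast h2.trans_lt h.sample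

/-- The exponent is at least `2 ^ 11 / (2 * 16 ^ 2) = 4` times the logarithm in the sample
condition. -/
theorem exp_sample_le (h : Admissible d δ k m T η) (hd : 1 ≤ d) (hδ : 0 < δ) (hδ' : δ < 1 / 2) :
    Real.exp (-(m * (patProb d * margin d / 16) ^ 2 / 2)) ≤ (δ / (8 * 2 ^ d * d)) ^ 4 := by
  have h1 := eight_lt hd hδ hδ'
  have h0 : 0 < δ / (8 * 2 ^ d * d) := by
    have : (0 : ℝ) < d := by exact_mod_cast hd
    positivity
  have hp : 0 < patProb d ^ 2 * margin d ^ 2 := by unfold patProb margin; positivity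
  have h2 := h.sample
  rw [div_mul_eq_mul_div, div_lt_iff₀ hp] at h2
  rw [← Real.le_log_iff_exp_le (by positivity), Real.log_pow,
    ← inv_div (8 * 2 ^ d * d : ℝ), Real.log_inv]
  push_cast
  nlinarith

end Admissible

/-- Here `n = 2 ^ d`, `q = (3/4)^k` and `2ndx = δ`. At `d = 1` the linear term `4(n - 1)x` already
uses all of `δ`, so the sampling failure, of order `x ^ 4`, is paid for by the cubic
inclusion–exclusion term. -/
theorem failure_le {n d q x : ℝ} (hn : 2 ≤ n) (hnd : 2 * (n - 1) ≤ n * d) (hq0 : 0 ≤ q)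
    (hqx : q ≤ x) (hx : x ≤ 1 / 8) :
    4 * n * (2 * (x / 4) ^ 4) + 2 * (n - 1) * (2 * q - q ^ 3) ≤ 2 * n * d * x := by
  have hx0 : 0 ≤ x := hq0.trans hqx
  -- The map `t ↦ 2t - t ^ 3` is increasing on `[0, 1/8]`.
  have h1 : 2 * q - q ^ 3 ≤ 2 * x - x ^ 3 := by
    have h : x ^ 2 + x * q + q ^ 2 ≤ 2 := by nlinarith
    have : 0 ≤ (x - q) * (2 - (x ^ 2 + x * q + q ^ 2)) :=
      mul_nonneg (by linarith) (by linarith)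
    nlinarith
  have h2 : 2 * (n - 1) * (2 * q - q ^ 3) ≤ 2 * (n - 1) * (2 * x - x ^ 3) :=
    mul_le_mul_of_nonneg_left h1 (by linarith)
  have h3 : 2 * (n - 1) * (2 * x) ≤ n * d * (2 * x) :=
    mul_le_mul_of_nonneg_right hnd (by linarith)
  have h4 : n * x ^ 4 ≤ 2 * (n - 1) * x ^ 3 := by
    have : n * x ≤ 2 * (n - 1) := by nlinarith
    have h5 : 0 ≤ x ^ 3 := by positivity
    nlinarith
  have h6 : 0 ≤ n * x ^ 4 := by positivity
  nlinarith

theorem measure_failure_le {d : ℕ} (hd : 1 ≤ d) (C : Circuit d) {δ : ℝ} (hδ : 0 < δ)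
    (hδ' : δ < 1 / 2) {k m T : ℕ} {η : ℝ} (hadm : Admissible d δ k m T η)
    {μ : Measure (ℝ × ℝ)} (hμ : IsInitLaw (1 / (4 * √2 * k)) μ) :
    C.law k m μ {ω | ¬ ∀ x : Fin (2 ^ d) → Bool,
      layerwiseGD T η (C.meanLabel + margin d / 4) ω.1 ω.2 (fun t => sgn (x t)) =
        sgn (C.eval x)} ≤ ENNReal.ofReal δ := by
  have := hμ.prob
  rw [C.meanLabel_eq_zero, zero_add]
  have hk := hadm.width_pos hd hδ hδ'
  have hm := hadm.sample_pos hd hδ hδ'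
  have hmar : 0 < margin d := by unfold margin; positivity
  have hmar1 : margin d ≤ 1 := pow_le_one₀ (by norm_num) (by norm_num)
  have hpp : 0 < patProb d := by unfold patProb; positivity
  set lam := margin d / 4 with hlam
  set τ := patProb d * margin d / 16 with hτ
  set PS := Measure.pi fun _ : Fin m => C.dist.toMeasure with hPS
  set PI := Measure.pi fun _ : Neuron d k => μ.prod (PMF.uniformOfFintype Bool).toMeasure with hPI
  set badS : Set (Sample d m) := {S | ¬ C.GoodSample lam τ S d le_rfl id} with hbadS
  set s : (Σ i : Fin d, Fin (2 ^ (i : ℕ))) → Bool × Bool → Bool :=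
    fun g => C.target g.1.isLt g.2 with hs
  set badI : Set (Init d k) := {θ | ¬ GoodInit s θ} with hbadI
  set nullI : Set (Init d k) :=
    {θ | ¬ ∀ n, |(θ n).1.1| ≤ 1 / (4 * √2 * k) ∧ |(θ n).1.2| ≤ 1 / (4 * √2 * k)} with hnullI
  -- The bad event of the sample does not involve `θ`, nor that of the initialization the sample, so
  -- failure is contained in a union of two cylinders.
  have hsub : {ω : Sample d m × Init d k | ¬ ∀ x : Fin (2 ^ d) → Bool,
      layerwiseGD T η lam ω.1 ω.2 (fun t => sgn (x t)) = sgn (C.eval x)} ⊆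
      badS ×ˢ Set.univ ∪ Set.univ ×ˢ (badI ∪ nullI) := by
    rintro ⟨S, θ⟩ hω
    by_contra hcon
    simp only [Set.mem_union, Set.mem_prod, Set.mem_univ, and_true, true_and, not_or, hbadS, hbadI,
      hnullI, Set.mem_ofPred_eq, not_not] at hcon
    obtain ⟨h1, h2, h3⟩ := hcon
    refine hω fun x => ?_
    exact trainFrom_eq hadm hk hd C S θ h2 h3 le_rfl (fun x => by simp [Circuit.netOrient]) h1
      (fun x => rfl) x
  have hS : PS badS ≤ ((4 * 2 ^ d : ℕ) : ENNReal) *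
      ENNReal.ofReal (2 * Real.exp (-(m * τ ^ 2 / 2))) :=
    C.measure_not_goodSample_le hm (by positivity) (by rw [hlam]; linarith) (by positivity) le_rfl
      (C.dist.map_id)
  have hI : PI badI ≤ _ := measure_not_goodInit_le hμ s
  have hN : PI nullI = 0 := measure_not_bounded_eq_zero hμ
  rw [card_gates, Nat.cast_sub Nat.one_le_two_pow] at hI
  push_cast at hI
  have hn : (2 : ℝ) ≤ 2 ^ d := by
    simpa only [pow_one] using pow_le_pow_right₀ (one_le_two : (1 : ℝ) ≤ 2) hd
  have hd1 : (1 : ℝ) ≤ d := by exact_mod_cast hd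
  have hnd : 2 * ((2 : ℝ) ^ d - 1) ≤ 2 ^ d * d := by
    rcases Nat.lt_or_ge d 2 with h | h
    · obtain rfl : d = 1 := by omega
      norm_num
    · have : (2 : ℝ) ≤ d := by exact_mod_cast h
      nlinarith
  set x := δ / (2 * 2 ^ d * d) with hx
  have hx8 : x ≤ 1 / 8 := by
    have h8 := Admissible.eight_lt hd hδ hδ'
    rw [lt_div_iff₀ hδ] at h8
    rw [hx, div_le_iff₀ (by positivity)]
    linarith
  have hq := hadm.pow_width_le hd hδ hδ'
  have hE := hadm.exp_sample_le hd hδ hδ'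
  have hx4 : δ / (8 * 2 ^ d * d) = x / 4 := by
    rw [hx, div_div]; congr 1; ring
  rw [hx4] at hE
  -- Because `27/64 ≤ 1/2`.
  have hr : ((3 / 4 : ℝ) ^ k) ^ 3 ≤ (1 / 2) ^ k := by
    rw [← pow_mul, mul_comm, pow_mul]
    exact pow_le_pow_left₀ (by norm_num) (by norm_num) k
  have hfinal := failure_le hn hnd (by positivity) hq hx8
  have hδx : 2 * 2 ^ d * d * x = δ := by
    rw [hx]; field_simp
  calc C.law k m μ _ ≤ (PS.prod PI) (badS ×ˢ Set.univ ∪ Set.univ ×ˢ (badI ∪ nullI)) :=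
        measure_mono hsub
    _ ≤ PS badS + (PI badI + PI nullI) := by
        refine (measure_union_le _ _).trans ?_
        rw [Measure.prod_prod, Measure.prod_prod, measure_univ, measure_univ, mul_one, one_mul]
        gcongr
        exact measure_union_le _ _
    _ ≤ ENNReal.ofReal (4 * 2 ^ d * (2 * (x / 4) ^ 4)) +
        ENNReal.ofReal (2 * (2 ^ d - 1) * (2 * (3 / 4) ^ k - ((3 / 4) ^ k) ^ 3)) := by
        rw [hN, add_zero]
        refine add_le_add (hS.trans ?_) (hI.trans (ENNReal.ofReal_le_ofReal ?_))
        · rw [← ENNReal.ofReal_natCast, ← ENNReal.ofReal_mul (by positivity)]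
          refine ENNReal.ofReal_le_ofReal ?_
          push_cast
          gcongr
        · refine mul_le_mul_of_nonneg_left (by linarith) (by linarith)
    _ = ENNReal.ofReal (4 * 2 ^ d * (2 * (x / 4) ^ 4) +
        2 * (2 ^ d - 1) * (2 * (3 / 4) ^ k - ((3 / 4) ^ k) ^ 3)) := by
        rw [ENNReal.ofReal_add (by positivity)]
        have h0 : (0 : ℝ) ≤ (3 / 4) ^ k := by positivity
        have h1 : ((3 / 4 : ℝ) ^ k) ^ 3 ≤ (3 / 4) ^ k :=
          pow_le_of_le_one h0 (pow_le_one₀ (by norm_num) (by norm_num)) (by norm_num)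
        exact mul_nonneg (by linarith) (by linarith)
    _ ≤ ENNReal.ofReal δ := ENNReal.ofReal_le_ofReal (by linarith)

open Timed

/-! ## Running time -/

theorem steps_ifLT_le {α : Type} {a b : ℝ} {p q : Timed α} {c : ℕ} (hp : p.steps ≤ c)
    (hq : q.steps ≤ c) : (ifLT a b p q).steps ≤ c + 1 := by
  unfold ifLT
  split_ifs
  · exact Nat.succ_le_succ hp
  · exact Nat.succ_le_succ hq

theorem steps_array_le {α : Type} {n : ℕ} {f : Fin n → Timed α} {c : ℕ}
    (h : ∀ i, (f i).steps ≤ c) : (array f).steps ≤ n * (c + 1) := by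
  calc ∑ i, ((f i).steps + 1) ≤ ∑ _i : Fin n, (c + 1) :=
        Finset.sum_le_sum fun i _ => Nat.succ_le_succ (h i)
    _ = n * (c + 1) := by simp

theorem steps_sum_le {n : ℕ} {f : Fin n → Timed ℝ} {c : ℕ}
    (h : ∀ i, (f i).steps ≤ c) : (Timed.sum f).steps ≤ n * (c + 2) := by
  calc ∑ i, ((f i).steps + 2) ≤ ∑ _i : Fin n, (c + 2) :=
        Finset.sum_le_sum fun i _ => Nat.add_le_add_right (h i) 2
    _ = n * (c + 2) := by simp

theorem steps_loop_le {α : Type} {f : α → Timed α} {c : ℕ} (h : ∀ a, (f a).steps ≤ c) (T : ℕ)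
    (a : α) : (loop f T a).steps ≤ T * (c + 1) := by
  induction T generalizing a with
  | zero => simp [loop]
  | succ T ih =>
    have h1 := h a
    have h2 := ih (f a).val
    simp only [loop, steps_bind]
    rw [add_mul, one_mul]
    omega

theorem steps_reluT_le (z : ℝ) : (reluT z).steps ≤ 1 :=
  steps_ifLT_le (c := 0) le_rfl le_rfl

theorem steps_hardTanhT_le (z : ℝ) : (hardTanhT z).steps ≤ 2 :=
  steps_ifLT_le (c := 1) (Nat.zero_le _) (steps_ifLT_le (c := 0) le_rfl le_rfl)

theorem steps_dReluT_le (z : ℝ) : (dReluT z).steps ≤ 1 :=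
  steps_ifLT_le (c := 0) le_rfl le_rfl

theorem steps_dHardTanhT_le (z : ℝ) : (dHardTanhT z).steps ≤ 2 :=
  steps_ifLT_le (c := 1) (steps_ifLT_le (c := 0) le_rfl le_rfl) (Nat.zero_le _)

theorem steps_dHingeT_le (y p : ℝ) : (dHingeT y p).steps ≤ 3 := by
  have : (ifLT (y * p) 1 (sub 0 y) (pure 0)).steps ≤ 2 :=
    steps_ifLT_le (c := 1) le_rfl (Nat.zero_le _)
  simp only [dHingeT, steps_bind, Timed.mul]
  omega

theorem steps_dRegT_le (lam p : ℝ) : (dRegT lam p).steps ≤ 2 :=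
  steps_ifLT_le (c := 1) le_rfl (steps_ifLT_le (c := 0) le_rfl le_rfl)

theorem steps_dotT (w x : ℝ × ℝ) : (dotT w x).steps = 3 := rfl

theorem steps_preactT_le {k : ℕ} (w : Fin k → ℝ × ℝ) (v : Fin k → ℝ) (x : ℝ × ℝ) :
    (preactT w v x).steps ≤ k * 7 := by
  refine steps_sum_le (c := 5) fun l => ?_
  have := steps_reluT_le (dotT (w l) x).val
  simp only [steps_bind, steps_dotT, Timed.mul]
  omega

theorem steps_blockT_le {k i : ℕ} (W : Fin (2 ^ i) → Fin k → ℝ × ℝ) (V : Fin (2 ^ i) → Fin k → ℝ)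
    (x : Fin (2 ^ (i + 1)) → ℝ) : (blockT W V x).steps ≤ 2 ^ i * (k * 7 + 2 + 1) := by
  refine steps_array_le fun j => ?_
  simp only [steps_bind]
  exact Nat.add_le_add (steps_preactT_le _ _ _) (steps_hardTanhT_le _)

theorem steps_avgPoolT_le {n : ℕ} (x : Fin n → ℝ) : (avgPoolT x).steps ≤ n * 2 + 1 := by
  have : (Timed.sum fun j => (pure (x j) : Timed ℝ)).steps ≤ n * 2 :=
    steps_sum_le (c := 0) fun j => le_rfl
  simp only [avgPoolT, steps_bind, Timed.div]
  omega

theorem steps_outGradT_le {k i : ℕ} (lam : ℝ) (V : Fin (2 ^ i) → Fin k → ℝ)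
    (W : Fin (2 ^ i) → Fin k → ℝ × ℝ) (z : Fin (2 ^ (i + 1)) → ℝ) (y : ℝ) :
    (outGradT lam V W z y).steps ≤ 2 ^ i * (k * 7 + 2 + 1) + (2 ^ i * 2 + 1) + 6 := by
  have h1 := steps_blockT_le W V z
  have h2 := steps_avgPoolT_le (blockT W V z).val
  have h3 := steps_dHingeT_le y (avgPoolT (blockT W V z).val).val
  have h4 := steps_dRegT_le lam (avgPoolT (blockT W V z).val).val
  simp only [outGradT, steps_bind, Timed.add]
  omega

theorem steps_coeffT_le {k i : ℕ} (V : Fin (2 ^ i) → Fin k → ℝ) (W : Fin (2 ^ i) → Fin k → ℝ × ℝ)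
    (z : Fin (2 ^ (i + 1)) → ℝ) (e : ℝ) (j : Fin (2 ^ i)) (l : Fin k) :
    (coeffT V W z e j l).steps ≤ k * 7 + 10 := by
  have h1 := steps_preactT_le (W j) (V j) (pair z j)
  have h2 := steps_dHardTanhT_le (preactT (W j) (V j) (pair z j)).val
  have h3 := steps_dReluT_le (dotT (W j l) (pair z j)).val
  simp only [coeffT, steps_bind, Timed.mul, Timed.div, steps_dotT]
  omega

theorem steps_gdStepT_le {m k i : ℕ} (η lam : ℝ) (z : Fin m → Fin (2 ^ (i + 1)) → ℝ)
    (y : Fin m → ℝ) (V : Fin (2 ^ i) → Fin k → ℝ) (W : Fin (2 ^ i) → Fin k → ℝ × ℝ) :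
    (gdStepT η lam z y V W).steps ≤
      m * (2 ^ i * (k * 7 + 2 + 1) + (2 ^ i * 2 + 1) + 6 + 1) +
        2 ^ i * (k * (m * (k * 7 + 10 + 1) + 6 * m + 6 + 1) + 1) := by
  unfold gdStepT
  rw [steps_bind]
  refine Nat.add_le_add (steps_array_le fun s => steps_outGradT_le _ _ _ _ _)
    (steps_array_le fun j => steps_array_le fun l => ?_)
  have h1 (e : Fin m → ℝ) : (array fun s => coeffT V W (z s) (e s) j l).steps ≤
      m * (k * 7 + 10 + 1) := steps_array_le fun s => steps_coeffT_le _ _ _ _ _ _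
  have h2 (c x : Fin m → ℝ) : (Timed.sum fun s => Timed.mul (c s) (x s)).steps ≤ m * 3 :=
    steps_sum_le (c := 1) fun s => le_rfl
  simp only [steps_bind, Timed.div, Timed.sub, steps_pure]
  generalize hc : (array fun s => coeffT V W (z s) _ j l) = c
  have h3 := h1 (array fun s => outGradT lam V W (z s) (y s)).val
  rw [hc] at h3
  have h4 := h2 c.val fun s => (pair (z s) j).1
  have h5 := h2 c.val fun s => (pair (z s) j).2
  simp only [Timed.mul] at h4 h5 ⊢
  omega

theorem steps_gdStepT_le_pow {m k i Q : ℕ} (hm : m ≤ Q) (hk : k ≤ Q) (hi : 2 ^ i ≤ Q) (η lam : ℝ)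
    (z : Fin m → Fin (2 ^ (i + 1)) → ℝ)
    (y : Fin m → ℝ) (V : Fin (2 ^ i) → Fin k → ℝ) (W : Fin (2 ^ i) → Fin k → ℝ × ℝ) :
    (gdStepT η lam z y V W).steps ≤ 60 * Q ^ 4 := by
  have hQ : 1 ≤ Q := Nat.one_le_two_pow.trans hi
  calc _ ≤ _ := steps_gdStepT_le η lam z y V W
    _ ≤ Q * (Q * (Q * 7 + 2 + 1) + (Q * 2 + 1) + 6 + 1) +
        Q * (Q * (Q * (Q * 7 + 10 + 1) + 6 * Q + 6 + 1) + 1) := by gcongr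
    _ = 7 * Q ^ 4 + 24 * Q ^ 3 + 12 * Q ^ 2 + 9 * Q := by ring
    _ ≤ 60 * Q ^ 4 := by
        have h1 : Q ≤ Q ^ 4 := Nat.le_self_pow (by norm_num) Q
        have h2 : Q ^ 2 ≤ Q ^ 4 := Nat.pow_le_pow_right hQ (by norm_num)
        have h3 : Q ^ 3 ≤ Q ^ 4 := Nat.pow_le_pow_right hQ (by norm_num)
        omega

/-- With one common bound `Q` for all sizes, a level costs at most `2 + 2 + 61 + 11 = 76` times `Q ^
5`: copying `V` and `W`, the descent loop, and the forward pass. -/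
theorem steps_trainFromT_le {d k m T Q : ℕ} (hm : m ≤ Q) (hk : k ≤ Q) (hT : T ≤ Q)
    (hd : 2 ^ d ≤ Q) (η lam : ℝ) (S : Sample d m) (θ : Init d k) {i : ℕ} (h : i ≤ d)
    (N : (Fin (2 ^ d) → ℝ) → Fin (2 ^ i) → ℝ) (z : Fin m → Fin (2 ^ i) → ℝ) :
    (trainFromT T η lam S θ i h N z).steps ≤ 1 + i * (76 * Q ^ 5) := by
  induction i with
  | zero => simp [trainFromT]
  | succ i ih =>
    have hi : 2 ^ i ≤ Q := (Nat.pow_le_pow_right two_pos (by omega)).trans hd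
    have hQ : 1 ≤ Q := Nat.one_le_two_pow.trans hi
    have hp (a : ℕ) (ha : a ≤ 5) : Q ^ a ≤ Q ^ 5 := Nat.pow_le_pow_right hQ ha
    have harr {α : Type} (f : Fin (2 ^ i) → Fin k → α) :
        (array fun j => array fun l => (pure (f j l) : Timed α)).steps ≤ 2 * Q ^ 5 := by
      refine (steps_array_le fun j => steps_array_le (c := 0) fun l => le_rfl).trans ?_
      calc 2 ^ i * (k * (0 + 1) + 1) ≤ Q * (Q + 1 * Q) := by
            gcongr
            · omega
            · omega
        _ = 2 * Q ^ 2 := by ring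
        _ ≤ 2 * Q ^ 5 := Nat.mul_le_mul_left _ (hp 2 (by norm_num))
    unfold trainFromT
    simp only [steps_bind]
    have h1 := harr fun j l => θ.V ⟨i, h⟩ j l
    have h2 := harr fun j l => θ.W ⟨i, h⟩ j l
    have h3 : (loop (gdStepT η lam z S.y
        (array fun j => array fun l => (pure (θ.V ⟨i, h⟩ j l) : Timed ℝ)).val) T
        (array fun j => array fun l => (pure (θ.W ⟨i, h⟩ j l) : Timed (ℝ × ℝ))).val).steps ≤
        61 * Q ^ 5 := by
      refine (steps_loop_le (fun W => steps_gdStepT_le_pow hm hk hi _ _ _ _ _ _) _ _).trans ?_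
      calc T * (60 * Q ^ 4 + 1) ≤ Q * (60 * Q ^ 4 + Q ^ 4) := by
            gcongr
            exact Nat.one_le_pow _ _ hQ
        _ = 61 * Q ^ 5 := by ring
    have h4 (W : Fin (2 ^ i) → Fin k → ℝ × ℝ) (V : Fin (2 ^ i) → Fin k → ℝ) :
        (array fun s => blockT W V (z s)).steps ≤ 11 * Q ^ 5 := by
      refine (steps_array_le fun s => steps_blockT_le _ _ _).trans ?_
      calc m * (2 ^ i * (k * 7 + 2 + 1) + 1) ≤ Q * (Q * (Q * 7 + 2 * Q + 1 * Q) + Q ^ 2) := by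
            gcongr
            · omega
            · omega
            · exact Nat.one_le_pow _ _ hQ
        _ = 11 * Q ^ 3 := by ring
        _ ≤ 11 * Q ^ 5 := Nat.mul_le_mul_left _ (hp 3 (by norm_num))
    refine (Nat.add_le_add h1 (Nat.add_le_add h2 (Nat.add_le_add h3 (Nat.add_le_add (h4 _ _)
      (ih _ _ _))))).trans ?_
    rw [add_mul, one_mul]
    omega

theorem steps_layerwiseGDT_le {d k m T Q : ℕ} (hm : m ≤ Q) (hk : k ≤ Q) (hT : T ≤ Q)
    (hd : 2 ^ d ≤ Q) (η lam : ℝ) (S : Sample d m) (θ : Init d k) :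
    (layerwiseGDT T η lam S θ).steps ≤ 80 * Q ^ 6 := by
  have hQ : 1 ≤ Q := Nat.one_le_two_pow.trans hd
  unfold layerwiseGDT
  rw [steps_bind]
  refine (Nat.add_le_add (steps_array_le fun s => steps_array_le (c := 0) fun t => le_rfl)
    (steps_trainFromT_le hm hk hT hd η lam S θ le_rfl _ _)).trans ?_
  have hdQ : d ≤ Q := Nat.lt_two_pow_self.le.trans hd
  calc _ ≤ Q * (Q * (0 + 1) + Q) + (Q ^ 2 + Q * (76 * Q ^ 5)) := by
        gcongr
        exact Nat.one_le_pow _ _ hQ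
    _ = 3 * Q ^ 2 + 76 * Q ^ 6 := by ring
    _ ≤ 80 * Q ^ 6 := by
        have : Q ^ 2 ≤ Q ^ 6 := Nat.pow_le_pow_right hQ (by norm_num)
        omega

/-! ### Admissible parameters of polynomial size -/

/-- Since `X ≥ 2`, constants can be absorbed into the exponent, so that every estimate becomes a
pure power of `X`. -/
theorem const_mul_pow_le {X c : ℝ} {a b : ℕ} (hX : 2 ≤ X) (hc : c ≤ 2 ^ a) :
    c * X ^ b ≤ X ^ (a + b) := by
  rw [pow_add]
  exact mul_le_mul_of_nonneg_right (hc.trans (pow_le_pow_left₀ zero_le_two hX a)) (by positivity)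

/-- All thresholds are polynomial in `n` and `log (1 / δ)`: `1/ε = n ^ 2`, `1/Δ ≤ n`, and `1/η` is
proportional to `k`. The parameters `m` and `T` are rounded to floor plus one because their
conditions are strict. -/
theorem exists_admissible {d : ℕ} (hd : 1 ≤ d) {δ : ℝ} (hδ : 0 < δ) (hδ' : δ < 1 / 2) :
    ∃ (k m T : ℕ) (η : ℝ), Admissible d δ k m T η ∧
      (m : ℝ) ≤ (2 ^ d + Real.log (1 / δ)) ^ 22 ∧ (k : ℝ) ≤ (2 ^ d + Real.log (1 / δ)) ^ 22 ∧
      (T : ℝ) ≤ (2 ^ d + Real.log (1 / δ)) ^ 22 := by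
  have hn : (2 : ℝ) ≤ 2 ^ d := by
    simpa only [pow_one] using pow_le_pow_right₀ (one_le_two : (1 : ℝ) ≤ 2) hd
  have hL : 0 ≤ Real.log (1 / δ) :=
    Real.log_nonneg (by rw [le_div_iff₀ hδ]; linarith)
  set X := 2 ^ d + Real.log (1 / δ) with hX
  have hX2 : 2 ≤ X := by linarith
  have hX0 : 0 < X := by linarith
  have hnX : (2 : ℝ) ^ d ≤ X := by linarith
  have hd1 : (1 : ℝ) ≤ d := by exact_mod_cast hd
  have hdX : (d : ℝ) ≤ 2 ^ d := by exact_mod_cast Nat.lt_two_pow_self.le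
  have hlogpos := Admissible.log_pos hd hδ hδ'
  have hlog : Real.log (8 * 2 ^ d * d / δ) ≤ X ^ 4 := by
    have e : Real.log (8 * 2 ^ d * d / δ) =
        Real.log 8 + Real.log (2 ^ d) + Real.log d + Real.log (1 / δ) := by
      rw [← Real.log_mul (by norm_num) (by positivity),
        ← Real.log_mul (by positivity) (by positivity),
        ← Real.log_mul (by positivity) (by positivity)]
      congr 1
      ring
    have h1 := Real.log_le_self (show (0 : ℝ) ≤ 8 by norm_num)
    have h2 := Real.log_le_self (show (0 : ℝ) ≤ 2 ^ d by positivity)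
    have h3 := Real.log_le_self (show (0 : ℝ) ≤ (d : ℝ) by positivity)
    have h4 := const_mul_pow_le (a := 3) (b := 1) (c := 8) hX2 (by norm_num)
    rw [pow_one] at h4
    rw [e]
    refine le_trans ?_ h4
    linarith
  have hsucc {x : ℝ} {a : ℕ} (h : x ≤ X ^ a) : x + 1 ≤ X ^ (a + 1) := by
    have h1 : 1 ≤ X ^ a := one_le_pow₀ (by linarith)
    rw [pow_succ]
    nlinarith
  have hlog43 : 1 / 4 ≤ Real.log (4 / 3) := by
    have := Real.one_sub_inv_le_log_of_pos (show (0 : ℝ) < 4 / 3 by norm_num)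
    norm_num at this ⊢
    linarith
  set kr := (Real.log (4 / 3))⁻¹ * Real.log (2 * 2 ^ d * d / δ) with hkr
  have h8 := Admissible.eight_lt hd hδ hδ'
  have hlog2 : 0 < Real.log (2 * 2 ^ d * d / δ) := Real.log_pos (by linarith)
  have hkr0 : 0 < kr := mul_pos (inv_pos.mpr (by linarith)) hlog2
  have hkrX : kr ≤ X ^ 6 := by
    have h1 : (Real.log (4 / 3))⁻¹ ≤ 4 := by
      rw [inv_le_comm₀ (by linarith) (by norm_num)]
      linarith
    have h2 : Real.log (2 * 2 ^ d * d / δ) ≤ Real.log (8 * 2 ^ d * d / δ) := by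
      refine Real.log_le_log (by linarith) ?_
      gcongr
      norm_num
    calc kr ≤ 4 * X ^ 4 := mul_le_mul h1 (h2.trans hlog) hlog2.le (by norm_num)
      _ ≤ X ^ (2 + 4) := const_mul_pow_le hX2 (by norm_num)
  set k := ⌈kr⌉₊ with hk
  have hk0 : (0 : ℝ) < k := by exact_mod_cast Nat.ceil_pos.mpr hkr0
  have hkX : (k : ℝ) ≤ X ^ 7 := (Nat.ceil_lt_add_one hkr0.le).le.trans (hsucc hkrX)
  have hs2 : 0 < √2 := by positivity
  have hpat : (patProb d)⁻¹ ≤ X ^ 2 := by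
    have : (patProb d)⁻¹ = (2 ^ d) ^ 2 := by
      rw [patProb, ← inv_pow, ← pow_mul, mul_comm, pow_mul]; norm_num
    rw [this]
    gcongr
  have hmar : (margin d)⁻¹ ≤ X := by
    rw [margin, ← inv_pow]
    refine le_trans ?_ hnX
    exact pow_le_pow_left₀ (by norm_num) (by norm_num) d
  have hp0 : 0 < patProb d := by unfold patProb; positivity
  have hm0 : 0 < margin d := by unfold margin; positivity
  set mr := 2 ^ 11 / (patProb d ^ 2 * margin d ^ 2) * Real.log (8 * 2 ^ d * d / δ) with hmr
  have hmr0 : 0 ≤ mr := by positivity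
  have hmrX : mr ≤ X ^ 21 := by
    calc mr = 2 ^ 11 * (((patProb d)⁻¹ ^ 2 * (margin d)⁻¹ ^ 2) *
          Real.log (8 * 2 ^ d * d / δ)) := by rw [hmr]; field_simp
      _ ≤ 2 ^ 11 * (((X ^ 2) ^ 2 * X ^ 2) * X ^ 4) := by gcongr
      _ = 2 ^ 11 * X ^ 10 := by ring
      _ ≤ X ^ (11 + 10) := const_mul_pow_le hX2 le_rfl
  set η := 1 / (16 * √2 * k) with hη
  have hη0 : 0 < η := by positivity
  set Tr := 6 * 2 ^ d / (√2 * η * patProb d * margin d) with hTr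
  have hTr0 : 0 ≤ Tr := by positivity
  have hTrX : Tr ≤ X ^ 18 := by
    calc Tr = 96 * (2 ^ d * k * ((patProb d)⁻¹ * (margin d)⁻¹)) := by
          rw [hTr, hη]; field_simp; norm_num
      _ ≤ 96 * (X * X ^ 7 * (X ^ 2 * X)) := by gcongr
      _ = 96 * X ^ 11 := by ring
      _ ≤ X ^ (7 + 11) := const_mul_pow_le hX2 (by norm_num)
  have hX1 : 1 ≤ X := by linarith
  refine ⟨k, ⌊mr⌋₊ + 1, ⌊Tr⌋₊ + 1, η, ⟨Nat.le_ceil _, hη0, le_rfl, ?_, ?_⟩, ?_, ?_, ?_⟩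
  · push_cast; exact Nat.lt_floor_add_one mr
  · push_cast; exact Nat.lt_floor_add_one Tr
  · push_cast; exact hsucc ((Nat.floor_le hmr0).trans hmrX)
  · exact hkX.trans (pow_le_pow_right₀ hX1 (by norm_num))
  · push_cast
    exact (hsucc ((Nat.floor_le hTr0).trans hTrX)).trans (pow_le_pow_right₀ hX1 (by norm_num))

theorem exists_polynomial_bound : ∃ A : ℕ, ∀ d : ℕ, 1 ≤ d → ∀ δ : ℝ, 0 < δ → δ < 1 / 2 →
    ∃ (k m T : ℕ) (η : ℝ), Admissible d δ k m T η ∧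
      (m : ℝ) ≤ A * (2 ^ d + Real.log (1 / δ)) ^ A ∧
      ∀ (lam : ℝ) (S : Sample d m) (θ : Init d k),
        ((layerwiseGDT T η lam S θ).steps : ℝ) ≤ A * (2 ^ d + Real.log (1 / δ)) ^ A := by
  -- The four sizes sum to at most `4 * X ^ 22 ≤ X ^ 24`, and `80 * (X ^ 24) ^ 6 = 80 * X ^ 144`;
  -- 160 exceeds both coefficient and exponent.
  refine ⟨160, fun d hd δ hδ hδ' => ?_⟩
  obtain ⟨k, m, T, η, hadm, hm, hk, hT⟩ := exists_admissible hd hδ hδ'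
  have hn : (2 : ℝ) ≤ 2 ^ d := by
    simpa only [pow_one] using pow_le_pow_right₀ (one_le_two : (1 : ℝ) ≤ 2) hd
  have hL : 0 ≤ Real.log (1 / δ) :=
    Real.log_nonneg (by rw [le_div_iff₀ hδ]; linarith)
  set X := 2 ^ d + Real.log (1 / δ) with hX
  have hX2 : 2 ≤ X := by linarith
  have hX1 : 1 ≤ X := by linarith
  have hnX : (2 : ℝ) ^ d ≤ X ^ 22 := by
    have : X ≤ X ^ 22 := le_self_pow₀ hX1 (by norm_num)
    linarith
  refine ⟨k, m, T, η, hadm, ?_, fun lam S θ => ?_⟩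
  · have h1 : X ^ 22 ≤ X ^ 160 := pow_le_pow_right₀ hX1 (by norm_num)
    have h2 : 0 ≤ X ^ 160 := by positivity
    push_cast
    linarith
  · have h1 := steps_layerwiseGDT_le (T := T) (Q := m + k + T + 2 ^ d)
      (by rw [add_assoc, add_assoc]; exact Nat.le_add_right _ _)
      (by rw [add_comm m, add_assoc, add_assoc]; exact Nat.le_add_right _ _)
      (by rw [add_right_comm]; exact Nat.le_add_left _ _) (Nat.le_add_left _ _) η lam S θ
    have h2 : ((layerwiseGDT T η lam S θ).steps : ℝ) ≤ 80 * ((m : ℝ) + k + T + 2 ^ d) ^ 6 := by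
      exact_mod_cast h1
    have h3 : (m : ℝ) + k + T + 2 ^ d ≤ X ^ (2 + 22) :=
      le_trans (by linarith) (const_mul_pow_le (c := 4) hX2 (by norm_num))
    calc _ ≤ _ := h2
      _ ≤ 80 * (X ^ (2 + 22)) ^ 6 := by gcongr
      _ = 80 * X ^ 144 := by rw [← pow_mul]
      _ ≤ ((160 : ℕ) : ℝ) * X ^ 160 := by
          push_cast
          refine mul_le_mul (by norm_num) (pow_le_pow_right₀ hX1 (by norm_num)) (by positivity)
            (by norm_num)

end TreeLearn

end

theorem mainTheorem5 :
    -- correctness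
    (∀ (d : ℕ), 1 ≤ d → ∀ (C : TreeLearn.Circuit d) (δ : ℝ), 0 < δ → δ < 1 / 2 →
      C.dist.toMeasure {s | s.2 ≠ C.eval s.1} = 0 ∧
      ∀ (k m T : ℕ) (η : ℝ), TreeLearn.Admissible d δ k m T η →
      ∀ μ : MeasureTheory.Measure (ℝ × ℝ), TreeLearn.IsInitLaw (1 / (4 * √2 * k)) μ →
        C.law k m μ {ω | ¬ ∀ x : Fin (2 ^ d) → Bool,
          TreeLearn.layerwiseGD T η (C.meanLabel + TreeLearn.margin d / 4) ω.1 ω.2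
            (fun t => TreeLearn.sgn (x t)) = TreeLearn.sgn (C.eval x)} ≤ ENNReal.ofReal δ) ∧
    -- sample size and running time
    (∃ A : ℕ, ∀ (d : ℕ), 1 ≤ d → ∀ (δ : ℝ), 0 < δ → δ < 1 / 2 →
      ∃ (k m T : ℕ) (η : ℝ), TreeLearn.Admissible d δ k m T η ∧
        (m : ℝ) ≤ A * (2 ^ d + Real.log (1 / δ)) ^ A ∧
        ∀ (lam : ℝ) (S : TreeLearn.Sample d m) (θ : TreeLearn.Init d k),
          ((TreeLearn.layerwiseGDT T η lam S θ).steps : ℝ) ≤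
            A * (2 ^ d + Real.log (1 / δ)) ^ A) := by
  exact ⟨fun d hd C δ hδ hδ' => ⟨C.measure_label_ne_eval, fun k m T η hadm μ hμ =>
    TreeLearn.measure_failure_le hd C hδ hδ' hadm hμ⟩, TreeLearn.exists_polynomial_bound⟩
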